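/- **Theorem.** A *shell* is a pair $(\nu,j)$ with $j\in\{0,\tfrac12,1,\dots\}$ and $\nu$ a label for additional quantum numbers; it has $2j+1$ single-particle states $m=-j,\dots,j$. Consider the fermionic Fock space over the single-particle states of a finite set of shells, with vacuum $|0\rangle$, creation operators $a^\dagger_{\nu jm}$ and total angular momentum operators $\hat J_\mu=\sum_{(\nu,j)}\sum_{m',m}\langle jm'|J_\mu|jm\rangle\,a^\dagger_{\nu jm'}a_{\nu jm}$, and put $\hat R(\alpha,\beta,\gamma)=e^{-i\alpha \hat J_z}e^{-i\beta \hat J_y}e^{-i\gamma \hat J_z}$, $$\hat P^J_{M'M}=\frac{2J+1}{8\pi^2}\int_0^{2\pi}\!d\alpha\int_0^{\pi}\!\sin\beta\,d\beta\int_0^{2\pi}\!d\gamma\;D^{J}_{M'M}(\alpha,\beta,\gamma)^*\,\hat R(\alpha,\beta,\gamma),$$ where $D^J_{M'M}$ is the Wigner $D$-function, $D^J_{M'M}(\alpha,\beta,\gamma)=\langle JM'|e^{-i\alpha J_z}e^{-i\beta J_y}e^{-i\gamma J_z}|JM\rangle$. Let $(\nu_1,j_1)$ and $(\nu_2,j_2)$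 be two of these shells, with $j_1\ne j_2$, or $j_1=j_2$ and $\nu_1\ne\nu_2$. Let $\phi_1^\dagger,\phi_1'^\dagger$ be products of $s$ creation operators of the first shell and $\phi_2^\dagger,\phi_2'^\dagger$ products of $t$ creation operators of the second shell. Put $|\phi_i\rangle=\phi_i^\dagger|0\rangle$, $|\phi_i'\rangle=\phi_i'^\dagger|0\rangle$, $|\phi\rangle=\phi_1^\dagger\phi_2^\dagger|0\rangle$ and $|\phi'\rangle=\phi_1'^\dagger\phi_2'^\dagger|0\rangle$. Let $M_i$ and $M_i'$ be the sums of the magnetic quantum numbers of the factors of $\phi_i^\dagger$ and $\phi_i'^\dagger$ (so $\hat J_z|\phi_i\rangle=M_i|\phi_i\rangle$ and $\hat J_z|\phi_i'\rangle=M_i'|\phi_i'\rangle$), and let $M=M_1+M_2$, $M'=M_1'+M_2'$. Then for every $J\in\{0,\tfrac12,1,\dots\}$ $$\langle\phi'|\hat P^J_{M'M}|\phi\rangle=\sum_{J_1,J_2}\langle\phi_1'|\hat P^{J_1}_{M_1'M_1}|\phi_1\rangle\,\langle\phi_2'|\hat P^{J_2}_{M_2'M_2}|\phi_2\rangle\,\langle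 J_1M_1'J_2M_2'|JM'\rangle\,\langle J_1M_1J_2M_2|JM\rangle ,$$ where $J_1,J_2$ run over $\{0,\tfrac12,1,\dots\}$, only finitely many terms are nonzero, and $\langle J_1M_1J_2M_2|JM\rangle$ are the Clebsch–Gordan coefficients with the Condon–Shortley phase convention. $D$-functions and Clebsch–Gordan coefficients are zero when one of the states $|JM\rangle$ in them does not exist ($|M|>J$ or $J-M\notin\mathbb Z$), and Clebsch–Gordan coefficients are also zero unless $|J_1-J_2|\le J\le J_1+J_2$ and $J_1+J_2-J\in\mathbb Z$. -/

import Mathlib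

/-! Angular momenta `j, J` and magnetic quantum numbers `m, M` are half-integers.  They are stored
through the integers `2j, 2J : ℕ` and `2m, 2M : ℤ`.  The `2j + 1` magnetic states of an angular
momentum `j` with `n = 2j` are indexed by `k : Fin (n + 1)`, where `k = j + m`. -/

open Matrix

noncomputable section

/-! ### The standard angular momentum matrices -/

/-- Twice the magnetic quantum number `m = k - j` of the `k`-th magnetic state, where `n = 2j`. -/
def twoM (n : ℕ) (k : Fin (n + 1)) : ℤ := 2 * (k : ℤ) - (n : ℤ)

/-- `J_z |j m⟩ = m |j m⟩`. -/
def spinZ (n : ℕ) : Matrix (Fin (n + 1)) (Fin (n + 1)) ℂ :=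
  Matrix.diagonal fun k => (twoM n k : ℂ) / 2

/-- `J_+ |j m⟩ = √((j - m) (j + m + 1)) |j (m + 1)⟩`. -/
def spinPlus (n : ℕ) : Matrix (Fin (n + 1)) (Fin (n + 1)) ℂ :=
  Matrix.of fun l k =>
    if (l : ℕ) = (k : ℕ) + 1 then ((Real.sqrt (((n : ℝ) - (k : ℝ)) * ((k : ℝ) + 1)) : ℝ) : ℂ)
    else 0

/-- `J_- = (J_+)†`. -/
def spinMinus (n : ℕ) : Matrix (Fin (n + 1)) (Fin (n + 1)) ℂ := (spinPlus n)ᴴ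

/-- `J_y = (J_+ - J_-) / (2i)`. -/
def spinY (n : ℕ) : Matrix (Fin (n + 1)) (Fin (n + 1)) ℂ :=
  (1 / (2 * Complex.I)) • (spinPlus n - spinMinus n)

/-- The rotation operator `exp(-iαJ_z) exp(-iβJ_y) exp(-iγJ_z)` with Euler angles `α, β, γ`. -/
def eulerRotation {ι : Type*} [Fintype ι] [DecidableEq ι] (Jz Jy : Matrix ι ι ℂ)
    (α β γ : ℝ) : Matrix ι ι ℂ :=
  NormedSpace.exp ((-Complex.I * (α : ℂ)) • Jz) * NormedSpace.exp ((-Complex.I * (β : ℂ)) • Jy) *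
    NormedSpace.exp ((-Complex.I * (γ : ℂ)) • Jz)

/-- The state `|J M⟩` with `n = 2J` and `M` given as `2M : ℤ`.  It is the zero vector if there is
no such state, that is, unless `|M| ≤ J` and `J - M` is an integer. -/
def ket (n : ℕ) (M : ℤ) : Fin (n + 1) → ℂ := fun k => if twoM n k = M then 1 else 0

/-- The Wigner function `D^J_{M' M}(α, β, γ) = ⟨J M'| R(α, β, γ) |J M⟩`, with `n = 2J`. -/
def wignerD (n : ℕ) (M' M : ℤ) (α β γ : ℝ) : ℂ :=
  star (ket n M') ⬝ᵥ (eulerRotation (spinZ n) (spinY n) α β γ *ᵥ ket n M)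

/-! ### Clebsch–Gordan coefficients (Condon–Shortley phase convention)

`a = 2J₁`, `b = 2J₂`, `c = 2J`. -/

/-- `J` occurs in the coupling of `J₁` and `J₂`: `|J₁ - J₂| ≤ J ≤ J₁ + J₂` and `J₁ + J₂ - J` is an
integer. -/
def Triangle (a b c : ℕ) : Prop :=
  Even (a + b + c) ∧ a ≤ b + c ∧ b ≤ a + c ∧ c ≤ a + b

/-- The total lowering operator `J_- ⊗ 1 + 1 ⊗ J_-` on the tensor product of `J₁` and `J₂`. -/
def coupledMinus (a b : ℕ) :
    Matrix (Fin (a + 1) × Fin (b + 1)) (Fin (a + 1) × Fin (b + 1)) ℂ :=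
  Matrix.kroneckerMap (· * ·) (spinMinus a) 1 + Matrix.kroneckerMap (· * ·) 1 (spinMinus b)

/-- The vector, unique up to a positive factor, with `M₁ + M₂ = J` that is annihilated by `J_+` and
whose component at `M₁ = J₁` is positive: its components are
`(-1)^(J₁ - M₁) √((J₁ + M₁)! (J₂ + M₂)! / ((J₁ - M₁)! (J₂ - M₂)!))`. -/
def highestVector (a b c : ℕ) : Fin (a + 1) × Fin (b + 1) → ℂ := fun k =>
  if 2 * ((k.1 : ℕ) + (k.2 : ℕ)) = a + b + c then
    (-1) ^ (a - (k.1 : ℕ)) *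
      ((Real.sqrt ((((k.1 : ℕ).factorial : ℝ) * ((k.2 : ℕ).factorial : ℝ)) /
        (((a - (k.1 : ℕ)).factorial : ℝ) * ((b - (k.2 : ℕ)).factorial : ℝ))) : ℝ) : ℂ)
  else 0

/-- The coupled state `|(J₁ J₂) J M⟩` with `k = J + M`: the normalized highest vector is `|J J⟩`,
and `|J M⟩ = √((J + M)! / ((2J)! (J - M)!)) (J_-)^(J - M) |J J⟩`. -/
def coupledKet (a b c : ℕ) (k : Fin (c + 1)) : Fin (a + 1) × Fin (b + 1) → ℂ :=
  ((Real.sqrt (((k : ℕ).factorial : ℝ) /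
      ((c.factorial : ℝ) * ((c - (k : ℕ)).factorial : ℝ))) : ℝ) : ℂ) •
    ((((Real.sqrt (∑ p, ‖highestVector a b c p‖ ^ 2))⁻¹ : ℝ) : ℂ) •
      ((coupledMinus a b) ^ (c - (k : ℕ)) *ᵥ highestVector a b c))

open Classical in
/-- The Clebsch–Gordan coefficient `⟨J₁ M₁ J₂ M₂ | J M⟩`, with all six arguments doubled.  It is
zero if `J` does not occur in the coupling or if one of the three states does not exist. -/
def clebschGordan (a : ℕ) (M₁ : ℤ) (b : ℕ) (M₂ : ℤ) (c : ℕ) (M : ℤ) : ℂ :=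
  if Triangle a b c then
    ∑ k : Fin (c + 1),
      (star (fun p : Fin (a + 1) × Fin (b + 1) => ket a M₁ p.1 * ket b M₂ p.2) ⬝ᵥ
        coupledKet a b c k) * ket c M k
  else 0

/-! ### Fermionic Fock space over finitely many modes, in the occupation number basis -/

section Fock

variable {ι : Type*} [Fintype ι] [LinearOrder ι]

/-- The creation operator `a_i†`: it sends `|T⟩` to `± |T ∪ {i}⟩`, the sign counting the occupied
modes before `i`, and to zero if `i` is already occupied. -/
def create (i : ι) : Matrix (Finset ι) (Finset ι) ℂ :=
  Matrix.of fun T' T => if i ∉ T ∧ T' = insert i T then (-1) ^ (T.filter (· < i)).card else 0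

variable (ι) in
/-- The vacuum `|0⟩`. -/
def vacuum : Finset ι → ℂ := Pi.single ∅ 1

end Fock

/-! ### Shells -/

/-- A `j`-shell, labelled by `2j` and by the collection `ν` of its additional quantum numbers. -/
structure Shell (N : Type*) where
  /-- The additional quantum numbers. -/
  ν : N
  /-- Twice the angular momentum `j`. -/
  twoJ : ℕ

/-- The single-particle states `(ν, j, m)` of a finite set of shells. -/
def Mode {N : Type*} (S : Finset (Shell N)) : Type _ := Σ s : S, Fin (s.1.twoJ + 1)

instance {N : Type*} (S : Finset (Shell N)) : Fintype (Mode S) :=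
  inferInstanceAs (Fintype (Σ s : S, Fin (s.1.twoJ + 1)))

section Shells

variable {N : Type*} (S : Finset (Shell N)) [LinearOrder (Mode S)]

/-- The creation operator of the single-particle state with magnetic index `k` in the shell `s`. -/
def createIn (s : S) (k : Fin (s.1.twoJ + 1)) : Matrix (Finset (Mode S)) (Finset (Mode S)) ℂ :=
  create (ι := Mode S) ⟨s, k⟩

/-- The annihilation operator of the same single-particle state. -/
def annihilateIn (s : S) (k : Fin (s.1.twoJ + 1)) :
    Matrix (Finset (Mode S)) (Finset (Mode S)) ℂ :=
  (createIn S s k)ᴴ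

/-- The second-quantized form `∑_s ∑_{m', m} ⟨j m'| A |j m⟩ a†_{s m'} a_{s m}` of a one-body
operator that acts within each shell through the matrix `A (2j)`. -/
def secondQuantized (A : (n : ℕ) → Matrix (Fin (n + 1)) (Fin (n + 1)) ℂ) :
    Matrix (Finset (Mode S)) (Finset (Mode S)) ℂ :=
  ∑ s : S, ∑ l : Fin (s.1.twoJ + 1), ∑ k : Fin (s.1.twoJ + 1),
    A s.1.twoJ l k • (createIn S s l * annihilateIn S s k)

/-- The rotation operator `R(α, β, γ)` on Fock space, generated by the total angular momentum. -/
def fockRotation (α β γ : ℝ) : Matrix (Finset (Mode S)) (Finset (Mode S)) ℂ :=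
  eulerRotation (secondQuantized S spinZ) (secondQuantized S spinY) α β γ

/-- The angular momentum projection operator
`P^J_{M' M} = (2J + 1) / (8π²) ∫ dα dβ dγ sin β D^J_{M' M}(α, β, γ)^* R(α, β, γ)`
on Fock space, with `n = 2J`; the integral is taken entry by entry. -/
def projection (n : ℕ) (M' M : ℤ) : Matrix (Finset (Mode S)) (Finset (Mode S)) ℂ :=
  Matrix.of fun T' T =>
    (((n : ℂ) + 1) / (8 * (Real.pi : ℂ) ^ 2)) *
      ∫ α in (0 : ℝ)..(2 * Real.pi), ∫ β in (0 : ℝ)..Real.pi, ∫ γ in (0 : ℝ)..(2 * Real.pi),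
        (Real.sin β : ℂ) * star (wignerD n M' M α β γ) * fockRotation S α β γ T' T

/-- The operator `φ† = a†_{s, m_1} ⋯ a†_{s, m_p}` creating `p` particles in the shell `s`. -/
def creator (s : S) {p : ℕ} (m : Fin p → Fin (s.1.twoJ + 1)) :
    Matrix (Finset (Mode S)) (Finset (Mode S)) ℂ :=
  (List.ofFn fun i => createIn S s (m i)).prod

/-- The Fock space state `A |0⟩`. -/
def stateOf (A : Matrix (Finset (Mode S)) (Finset (Mode S)) ℂ) : Finset (Mode S) → ℂ :=
  A *ᵥ vacuum (Mode S)

end Shells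

/-- Twice the total magnetic quantum number `m_1 + ⋯ + m_p`. -/
def totalTwoM {n p : ℕ} (m : Fin p → Fin (n + 1)) : ℤ := ∑ i, twoM n (m i)

/-- The matrix element `⟨ψ| A |φ⟩`. -/
def matrixElement {κ : Type*} [Fintype κ] (ψ : κ → ℂ) (A : Matrix κ κ ℂ) (φ : κ → ℂ) : ℂ :=
  star ψ ⬝ᵥ (A *ᵥ φ)

end

/-! Both states are eigenstates of `J_z`, so the integrals over `α` and `γ` only cancel phases, and
the matrix element of the projection is a multiple of `∫ sin β d^J_{M' M}(β)^* f(β) dβ`, where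
`f(β)` is the matrix element of the rotation by `β` about the `y`-axis.  A rotation acts on each
creation operator separately and operators of different shells anticommute, so that `f = f₁ f₂`
with one factor for each shell.  Each `f_i` is a finite combination of the reduced Wigner functions
`d^{J_i}_{M_i' M_i}`, because products of these are expanded by the Clebsch–Gordan series, and by
orthogonality the coefficients are the matrix elements of the projections in a single shell.
Expanding `f₁ f₂` by the Clebsch–Gordan series once more gives the theorem.

Orthogonality of the reduced Wigner functions is also a consequence of the Clebsch–Gordan series:
it reduces to `∫ sin β d^J_{00}(β) dβ = 0` for `J ≠ 0`, and the coefficients of the terms with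
`J = 0` are known. -/

noncomputable section

open scoped Kronecker

/-! ### Matrix exponentials, eigenvectors and rotations -/

section Exponential

variable {ι κ : Type*} [Fintype ι] [Fintype κ]

open scoped Matrix.Norms.Operator in
theorem exp_mul_eq_mul_exp [DecidableEq ι] [DecidableEq κ] {A : Matrix ι ι ℂ} {B : Matrix κ κ ℂ}
    {U : Matrix ι κ ℂ} (h : A * U = U * B) : NormedSpace.exp A * U = U * NormedSpace.exp B := by
  have hpow (n : ℕ) : A ^ n * U = U * B ^ n := by
    induction n with
    | zero => simp
    | succ n ih => rw [pow_succ, Matrix.mul_assoc, h, ← Matrix.mul_assoc, ih, Matrix.mul_assoc,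
        ← pow_succ]
  have hA := (NormedSpace.exp_series_hasSum_exp' (𝕂 := ℂ) A).map (addMonoidHomMulRight U)
    (show Continuous fun X => X * U from continuous_id.matrix_mul continuous_const)
  have hB := (NormedSpace.exp_series_hasSum_exp' (𝕂 := ℂ) B).map (addMonoidHomMulLeft U)
    (show Continuous fun X => U * X from continuous_const.matrix_mul continuous_id)
  refine hA.unique (hB.congr_fun ?_)
  simp [addMonoidHomMulLeft, addMonoidHomMulRight, hpow]

open scoped Matrix.Norms.Operator in
theorem exp_submatrix_equiv [DecidableEq ι] [DecidableEq κ] (A : Matrix ι ι ℂ) (e : κ ≃ ι) :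
    NormedSpace.exp (A.submatrix e e) = (NormedSpace.exp A).submatrix e e :=
  have hcont : Continuous (reindexAlgEquiv ℂ ℂ e.symm) := continuous_id.matrix_reindex _ _
  (NormedSpace.map_exp (reindexAlgEquiv ℂ ℂ e.symm) hcont A).symm

theorem exp_mulVec_of_mulVec_eq_smul [DecidableEq ι] {A : Matrix ι ι ℂ} {v : ι → ℂ} {μ : ℂ}
    (h : A *ᵥ v = μ • v) : NormedSpace.exp A *ᵥ v = Complex.exp μ • v := by
  have hcol : A * replicateCol Unit v =
      replicateCol Unit v * (diagonal fun _ => μ : Matrix Unit Unit ℂ) := by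
    rw [← replicateCol_mulVec, h]
    ext
    simp [mul_diagonal, mul_comm]
  have hexp := exp_mul_eq_mul_exp hcol
  rw [exp_diagonal, ← replicateCol_mulVec] at hexp
  ext i
  simpa [mul_diagonal, Pi.coe_exp, ← Complex.exp_eq_exp_ℂ, mul_comm] using congrFun₂ hexp i ()

theorem vecMul_exp_of_vecMul_eq_smul [DecidableEq ι] {A : Matrix ι ι ℂ} {v : ι → ℂ} {μ : ℂ}
    (h : v ᵥ* A = μ • v) : v ᵥ* NormedSpace.exp A = Complex.exp μ • v := by
  rw [← mulVec_transpose, ← exp_transpose]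
  exact exp_mulVec_of_mulVec_eq_smul (by rwa [mulVec_transpose])

theorem star_vecMul_eq_smul_of_isHermitian {A : Matrix ι ι ℂ} (hA : A.IsHermitian)
    {v : ι → ℂ} {μ : ℝ} (h : A *ᵥ v = (μ : ℂ) • v) : star v ᵥ* A = (μ : ℂ) • star v := by
  rw [← hA.eq, ← star_mulVec, h, star_smul, Complex.star_def, Complex.conj_ofReal]

theorem star_dotProduct_eq_zero_of_isHermitian {A : Matrix ι ι ℂ} (hA : A.IsHermitian)
    {v w : ι → ℂ} {μ ν : ℝ} (hv : A *ᵥ v = (μ : ℂ) • v) (hw : A *ᵥ w = (ν : ℂ) • w) (h : μ ≠ ν) :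
    star v ⬝ᵥ w = 0 := by
  have hμν : (μ : ℂ) * (star v ⬝ᵥ w) = ν * (star v ⬝ᵥ w) := by
    simpa [star_vecMul_eq_smul_of_isHermitian hA hv, hw] using (dotProduct_mulVec (star v) A w).symm
  by_contra h0
  exact h (by exact_mod_cast mul_right_cancel₀ h0 hμν)

variable [DecidableEq ι]

/-- The rotation `exp(-itA)` by the angle `t` that the component `A` of an angular momentum
generates; `eulerRotation` is a product of three of them. -/
def axisRotation (A : Matrix ι ι ℂ) (t : ℝ) : Matrix ι ι ℂ :=
  NormedSpace.exp ((-Complex.I * (t : ℂ)) • A)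

theorem axisRotation_mul_eq_mul_axisRotation [DecidableEq κ] {A : Matrix ι ι ℂ} {B : Matrix κ κ ℂ}
    {U : Matrix ι κ ℂ} (h : A * U = U * B) (t : ℝ) : axisRotation A t * U = U * axisRotation B t :=
  exp_mul_eq_mul_exp (by rw [Matrix.smul_mul, h, Matrix.mul_smul])

theorem axisRotation_mulVec_of_mulVec_eq_smul {A : Matrix ι ι ℂ} {v : ι → ℂ} {μ : ℂ}
    (h : A *ᵥ v = μ • v) (t : ℝ) : axisRotation A t *ᵥ v = Complex.exp (-Complex.I * t * μ) • v :=
  exp_mulVec_of_mulVec_eq_smul (by rw [smul_mulVec, h, smul_smul])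

theorem vecMul_axisRotation_of_vecMul_eq_smul {A : Matrix ι ι ℂ} {v : ι → ℂ} {μ : ℂ}
    (h : v ᵥ* A = μ • v) (t : ℝ) : v ᵥ* axisRotation A t = Complex.exp (-Complex.I * t * μ) • v :=
  vecMul_exp_of_vecMul_eq_smul (by rw [vecMul_smul, h, smul_smul])

open scoped Matrix.Norms.Operator in
@[fun_prop]
theorem continuous_axisRotation (A : Matrix ι ι ℂ) : Continuous (axisRotation A) :=
  (NormedSpace.exp_continuous (𝔸 := Matrix ι ι ℂ)).comp (by fun_prop)

theorem eulerRotation_eq_axisRotation_mul (Z Y : Matrix ι ι ℂ) (α β γ : ℝ) :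
    eulerRotation Z Y α β γ = axisRotation Z α * axisRotation Y β * axisRotation Z γ := rfl

theorem continuous_eulerRotation (Z Y : Matrix ι ι ℂ) :
    Continuous fun x : ℝ × ℝ × ℝ => eulerRotation Z Y x.1 x.2.1 x.2.2 := by
  simp only [eulerRotation_eq_axisRotation_mul]
  fun_prop

theorem star_dotProduct_eulerRotation_mulVec {Z : Matrix ι ι ℂ} (hZ : Z.IsHermitian)
    (Y : Matrix ι ι ℂ) {v w : ι → ℂ} {μ ν : ℝ} (hv : Z *ᵥ v = (μ : ℂ) • v)
    (hw : Z *ᵥ w = (ν : ℂ) • w) (α β γ : ℝ) :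
    star v ⬝ᵥ (eulerRotation Z Y α β γ *ᵥ w) =
      Complex.exp (-Complex.I * α * μ) * Complex.exp (-Complex.I * γ * ν) *
        (star v ⬝ᵥ (axisRotation Y β *ᵥ w)) := by
  rw [eulerRotation_eq_axisRotation_mul, ← mulVec_mulVec, ← mulVec_mulVec,
    axisRotation_mulVec_of_mulVec_eq_smul hw, dotProduct_mulVec,
    vecMul_axisRotation_of_vecMul_eq_smul (star_vecMul_eq_smul_of_isHermitian hZ hv), mulVec_smul,
    smul_dotProduct, dotProduct_smul, smul_eq_mul, smul_eq_mul]
  ring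

end Exponential

/-! ### Angular momentum operators -/

section AngularMomentum

variable {ι κ : Type*}

/-- The component `J_y = (J_+ - J_-) / (2i)` of the angular momentum with raising operator `P`. -/
def yComponent (P : Matrix ι ι ℂ) : Matrix ι ι ℂ := (1 / (2 * Complex.I)) • (P - Pᴴ)

theorem yComponent_isHermitian (P : Matrix ι ι ℂ) : (yComponent P).IsHermitian := by
  rw [IsHermitian, yComponent, conjTranspose_smul, conjTranspose_sub, conjTranspose_conjTranspose,
    ← neg_sub, smul_neg, ← neg_smul]
  congr 1
  simp

variable [Fintype ι] [Fintype κ]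

/-- `Z` and `P` are the components `J_z` and `J_+` of an angular momentum.  Unlike in an
`sl₂`-triple, `Z` may be zero, as it is for spin `0`. -/
structure IsAngularMomentum (Z P : Matrix ι ι ℂ) : Prop where
  isHermitian : Z.IsHermitian
  lie_plus : ⁅Z, P⁆ = P
  lie_plus_minus : ⁅P, Pᴴ⁆ = (2 : ℂ) • Z

/-- The Casimir operator `J² = J_- J_+ + J_z² + J_z` of an angular momentum. -/
def casimir (Z P : Matrix ι ι ℂ) : Matrix ι ι ℂ := Pᴴ * P + Z * Z + Z

theorem yComponent_mul_eq_mul_yComponent {P : Matrix ι ι ℂ} {Q : Matrix κ κ ℂ} {U : Matrix ι κ ℂ}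
    (h : P * U = U * Q) (h' : Pᴴ * U = U * Qᴴ) : yComponent P * U = U * yComponent Q := by
  rw [yComponent, yComponent, Matrix.smul_mul, Matrix.mul_smul, Matrix.sub_mul, Matrix.mul_sub, h,
    h']

namespace IsAngularMomentum

variable {Z P : Matrix ι ι ℂ}

theorem lie_minus (H : IsAngularMomentum Z P) : ⁅Z, Pᴴ⁆ = -Pᴴ := by
  have h := congrArg conjTranspose H.lie_plus
  rw [Ring.lie_def, conjTranspose_sub, conjTranspose_mul, conjTranspose_mul, H.isHermitian.eq] at h
  rw [Ring.lie_def, ← neg_sub, h]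

theorem casimir_isHermitian (H : IsAngularMomentum Z P) : (casimir Z P).IsHermitian := by
  simp [IsHermitian, casimir, H.isHermitian.eq]

theorem kronecker_add [DecidableEq ι] [DecidableEq κ] {Z' P' : Matrix κ κ ℂ}
    (H : IsAngularMomentum Z P) (H' : IsAngularMomentum Z' P') :
    IsAngularMomentum (Z ⊗ₖ 1 + 1 ⊗ₖ Z') (P ⊗ₖ 1 + 1 ⊗ₖ P') := by
  have lie_add (A B : Matrix ι ι ℂ) (A' B' : Matrix κ κ ℂ) :
      ⁅A ⊗ₖ 1 + 1 ⊗ₖ A', B ⊗ₖ 1 + 1 ⊗ₖ B'⁆ = ⁅A, B⁆ ⊗ₖ 1 + 1 ⊗ₖ ⁅A', B'⁆ := by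
    have hsub : ⁅A, B⁆ ⊗ₖ (1 : Matrix κ κ ℂ) = (A * B) ⊗ₖ 1 - (B * A) ⊗ₖ 1 := by
      ext
      simp [Ring.lie_def, sub_mul]
    have hsub' : (1 : Matrix ι ι ℂ) ⊗ₖ ⁅A', B'⁆ = 1 ⊗ₖ (A' * B') - 1 ⊗ₖ (B' * A') := by
      ext
      simp [Ring.lie_def, mul_sub]
    rw [hsub, hsub', Ring.lie_def]
    simp only [Matrix.add_mul, Matrix.mul_add, ← mul_kronecker_mul, Matrix.one_mul, Matrix.mul_one]
    abel
  refine ⟨?_, by rw [lie_add, H.lie_plus, H'.lie_plus], ?_⟩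
  · simp [IsHermitian, conjTranspose_kronecker, H.isHermitian.eq, H'.isHermitian.eq]
  · rw [conjTranspose_add, conjTranspose_kronecker, conjTranspose_kronecker, conjTranspose_one,
      conjTranspose_one, lie_add, H.lie_plus_minus, H'.lie_plus_minus, smul_kronecker,
      kronecker_smul, smul_add]

end IsAngularMomentum

end AngularMomentum

/-! ### The spin matrices -/

section Spin

variable {n : ℕ}

theorem spinY_eq_yComponent (n : ℕ) : spinY n = yComponent (spinPlus n) := rfl

theorem spinMinus_apply (l k : Fin (n + 1)) : spinMinus n l k = spinPlus n k l := by
  simp only [spinMinus, conjTranspose_apply, spinPlus, of_apply]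
  split_ifs <;> simp

theorem spinPlus_rev_rev (l k : Fin (n + 1)) : spinPlus n l.rev k.rev = spinPlus n k l := by
  simp only [spinPlus, of_apply, Fin.val_rev]
  refine if_ctx_congr (by omega) (fun h => ?_) fun _ => rfl
  have hk : ((n + 1 - (k + 1) : ℕ) : ℝ) = n - k := by
    rw [Nat.cast_sub k.2]
    push_cast
    ring
  rw [hk, h]
  push_cast
  ring_nf

theorem spinMinus_submatrix_rev : (spinMinus n).submatrix Fin.rev Fin.rev = spinPlus n := by
  ext l k
  rw [submatrix_apply, spinMinus_apply, spinPlus_rev_rev]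

theorem spinPlus_submatrix_rev : (spinPlus n).submatrix Fin.rev Fin.rev = spinMinus n := by
  ext l k
  rw [submatrix_apply, spinPlus_rev_rev, spinMinus_apply]

theorem sum_mul_spinPlus (f : ℕ → ℂ) (k : Fin (n + 1)) :
    ∑ l : Fin (n + 1), f l * spinPlus n l k =
      f (k + 1) * (Real.sqrt (((n : ℝ) - k) * (k + 1)) : ℝ) := by
  rcases (Fin.is_le k).eq_or_lt with hk | hk
  · have hsum (l : Fin (n + 1)) : spinPlus n l k = 0 := by simp [spinPlus, hk]
    simp [hsum, hk]
  · rw [Finset.sum_eq_single ⟨k + 1, by omega⟩]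
    · simp [spinPlus]
    · intro l _ hl
      rw [spinPlus, of_apply, if_neg fun h => hl (Fin.ext h), mul_zero]
    · simp

theorem sum_mul_spinMinus (f : ℕ → ℂ) (k : Fin (n + 1)) :
    ∑ l : Fin (n + 1), f l * spinMinus n l k =
      f (k - 1) * (Real.sqrt (((n : ℝ) - k + 1) * k) : ℝ) := by
  have h := sum_mul_spinPlus (fun l => f (n - l)) k.rev
  rw [← Equiv.sum_comp Fin.revPerm] at h
  simp only [Fin.revPerm_apply, spinPlus_rev_rev] at h
  have hrev (l : Fin (n + 1)) : n - (l.rev : ℕ) = l := by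
    rw [Fin.val_rev]
    omega
  have hk : ((k.rev : ℕ) : ℝ) = n - k := by
    rw [Fin.val_rev, Nat.cast_sub k.2]
    push_cast
    ring
  rw [hk, ← Nat.sub_sub, hrev k, sub_sub_cancel, mul_comm (k : ℝ)] at h
  simpa only [hrev, ← spinMinus_apply] using h

theorem spinMinus_mul_spinPlus (n : ℕ) : spinMinus n * spinPlus n =
    diagonal fun k : Fin (n + 1) => ((n : ℂ) - k) * (k + 1) := by
  ext l k
  have h := sum_mul_spinPlus (fun m => if m = l + 1 then
    ((Real.sqrt (((n : ℝ) - l) * (l + 1)) : ℝ) : ℂ) else 0) k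
  rw [mul_apply]
  simp only [spinMinus_apply]
  refine Eq.trans (by simp only [spinPlus, of_apply]) (h.trans ?_)
  rw [diagonal_apply]
  rcases eq_or_ne l k with rfl | hlk
  · have hl : (0 : ℝ) ≤ n - l := sub_nonneg.2 (by exact_mod_cast l.is_le)
    rw [if_pos rfl, if_pos rfl, ← Complex.ofReal_mul, Real.mul_self_sqrt (by positivity)]
    push_cast
    ring
  · rw [if_neg hlk, if_neg (by omega), zero_mul]

theorem spinPlus_mul_spinMinus (n : ℕ) : spinPlus n * spinMinus n =
    diagonal fun k : Fin (n + 1) => (k : ℂ) * (n - k + 1) := by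
  have hrev : spinPlus n * spinMinus n = (spinMinus n * spinPlus n).submatrix Fin.rev Fin.rev := by
    rw [submatrix_mul _ _ _ _ _ Fin.rev_bijective, spinMinus_submatrix_rev, spinPlus_submatrix_rev]
  rw [hrev, spinMinus_mul_spinPlus, submatrix_diagonal _ _ Fin.rev_injective]
  congr 1
  ext k
  rw [Function.comp_apply, Fin.val_rev, Nat.cast_sub k.2]
  push_cast
  ring

theorem spinZ_isHermitian (n : ℕ) : (spinZ n).IsHermitian := by
  refine isHermitian_diagonal_of_self_adjoint _ ?_
  ext k
  simp

theorem isAngularMomentum_spin (n : ℕ) : IsAngularMomentum (spinZ n) (spinPlus n) where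
  isHermitian := spinZ_isHermitian n
  lie_plus := by
    ext l k
    simp only [Ring.lie_def, spinZ, Matrix.sub_apply, diagonal_mul, mul_diagonal, spinPlus,
      of_apply]
    split_ifs with h
    · simp only [twoM, h]
      push_cast
      ring
    · simp
  lie_plus_minus := by
    rw [Ring.lie_def]
    change spinPlus n * spinMinus n - spinMinus n * spinPlus n = _
    rw [spinPlus_mul_spinMinus, spinMinus_mul_spinPlus, diagonal_sub, spinZ, ← diagonal_smul]
    congr 1
    ext k
    simp only [twoM, Pi.smul_apply, smul_eq_mul]
    push_cast
    ring

end Spin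

/-! ### Highest weight vectors and their multiplets -/

section Ladder

variable {ι : Type*} [Fintype ι]

theorem star_conjTranspose_mulVec_dotProduct (P : Matrix ι ι ℂ) (v w : ι → ℂ) :
    star (Pᴴ *ᵥ v) ⬝ᵥ w = star v ⬝ᵥ (P *ᵥ w) := by
  rw [star_mulVec, conjTranspose_conjTranspose, dotProduct_mulVec]

/-- `v` is a nonzero vector of weight `c / 2` that is annihilated by the raising operator `P` of an
angular momentum; it generates an irreducible multiplet with `2J = c`. -/
structure IsHighestWeight (Z P : Matrix ι ι ℂ) (c : ℕ) (v : ι → ℂ) : Prop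
    extends IsAngularMomentum Z P where
  plus_mulVec : P *ᵥ v = 0
  z_mulVec : Z *ᵥ v = ((c : ℂ) / 2) • v
  ne_zero : v ≠ 0

/-- The factor in the definition of the state `|J M⟩`, with `c = 2J` and `k = J + M`, of a
multiplet, chosen as in `coupledKet` so that all states get the norm of the highest one. -/
def ladderCoeff (c k : ℕ) : ℝ :=
  Real.sqrt ((k.factorial : ℝ) / ((c.factorial : ℝ) * ((c - k).factorial : ℝ)))

/-- The normalized state `|J M⟩`, with `c = 2J` and `k = J + M`, of the multiplet with highest
weight vector `v`. -/
def multiplet (P : Matrix ι ι ℂ) [DecidableEq ι] (c : ℕ) (v : ι → ℂ) (k : ℕ) : ι → ℂ :=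
  (ladderCoeff c k : ℂ) •
    ((((Real.sqrt (∑ p, ‖v p‖ ^ 2))⁻¹ : ℝ) : ℂ) • (Pᴴ ^ (c - k) *ᵥ v))

/-- The matrix whose columns are the states of a multiplet, in the order of increasing `M`. -/
def multipletMatrix (P : Matrix ι ι ℂ) [DecidableEq ι] (c : ℕ) (v : ι → ℂ) :
    Matrix ι (Fin (c + 1)) ℂ :=
  of fun p k => multiplet P c v k p

theorem ladderCoeff_succ {c k : ℕ} (hk : k < c) :
    ladderCoeff c (k + 1) = Real.sqrt (((c : ℝ) - k) * (k + 1)) * ladderCoeff c k := by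
  obtain ⟨i, rfl⟩ := Nat.exists_eq_add_of_lt hk
  have hi : ((k + i + 1 : ℕ) : ℝ) - k = i + 1 := by push_cast; ring
  rw [ladderCoeff, ladderCoeff, hi, ← Real.sqrt_mul (by positivity), Nat.factorial_succ k,
    show k + i + 1 - (k + 1) = i by omega, show k + i + 1 - k = i + 1 by omega,
    Nat.factorial_succ i]
  congr 1
  push_cast
  field_simp

theorem ladderCoeff_self (c : ℕ) : ladderCoeff c c = 1 := by
  simp [ladderCoeff, Nat.factorial_ne_zero]

namespace IsHighestWeight

variable [DecidableEq ι] {Z P : Matrix ι ι ℂ} {v w : ι → ℂ} {c d : ℕ}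

theorem z_pow (H : IsHighestWeight Z P c v) (i : ℕ) :
    Z *ᵥ (Pᴴ ^ i *ᵥ v) = ((c : ℂ) / 2 - i) • (Pᴴ ^ i *ᵥ v) := by
  have hcomm : Z * Pᴴ = Pᴴ * Z - Pᴴ := by
    rw [sub_eq_add_neg, ← H.lie_minus, Ring.lie_def]
    abel
  induction i with
  | zero => simp [H.z_mulVec]
  | succ i ih =>
    rw [pow_succ', ← mulVec_mulVec, mulVec_mulVec, hcomm, sub_mulVec, ← mulVec_mulVec, ih,
      mulVec_smul]
    push_cast
    module

theorem plus_pow_succ (H : IsHighestWeight Z P c v) (i : ℕ) :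
    P *ᵥ (Pᴴ ^ (i + 1) *ᵥ v) = (((i : ℂ) + 1) * (c - i)) • (Pᴴ ^ i *ᵥ v) := by
  have hcomm : P * Pᴴ = Pᴴ * P + (2 : ℂ) • Z := by
    rw [← H.lie_plus_minus, Ring.lie_def]
    abel
  have hstep (i : ℕ) : P *ᵥ (Pᴴ ^ (i + 1) *ᵥ v) =
      Pᴴ *ᵥ (P *ᵥ (Pᴴ ^ i *ᵥ v)) + (c - 2 * i : ℂ) • (Pᴴ ^ i *ᵥ v) := by
    rw [pow_succ', ← mulVec_mulVec, mulVec_mulVec, hcomm, add_mulVec, ← mulVec_mulVec, smul_mulVec,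
      H.z_pow]
    module
  induction i with
  | zero =>
    rw [hstep]
    simp [H.plus_mulVec]
  | succ i ih =>
    rw [hstep, ih, mulVec_smul, mulVec_mulVec, ← pow_succ']
    push_cast
    module

open scoped ComplexOrder in
theorem minus_pow_succ_eq_zero (H : IsHighestWeight Z P c v) : Pᴴ ^ (c + 1) *ᵥ v = 0 := by
  refine dotProduct_star_self_eq_zero.1 ?_
  nth_rewrite 1 [pow_succ']
  rw [← mulVec_mulVec, star_conjTranspose_mulVec_dotProduct, H.plus_pow_succ, sub_self, mul_zero,
    zero_smul, dotProduct_zero]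

theorem casimir_pow (H : IsHighestWeight Z P c v) (i : ℕ) :
    casimir Z P *ᵥ (Pᴴ ^ i *ᵥ v) = (((c : ℝ) / 2 * (c / 2 + 1) : ℝ) : ℂ) • (Pᴴ ^ i *ᵥ v) := by
  have hminus_plus : Pᴴ *ᵥ (P *ᵥ (Pᴴ ^ i *ᵥ v)) = ((i : ℂ) * (c - i + 1)) • (Pᴴ ^ i *ᵥ v) := by
    cases i with
    | zero => simp [H.plus_mulVec]
    | succ i =>
      rw [H.plus_pow_succ, mulVec_smul, mulVec_mulVec, ← pow_succ']
      push_cast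
      module
  rw [casimir, add_mulVec, add_mulVec, ← mulVec_mulVec, ← mulVec_mulVec, hminus_plus, H.z_pow,
    mulVec_smul, H.z_pow]
  push_cast
  module

theorem z_multiplet (H : IsHighestWeight Z P c v) {k : ℕ} (hk : k ≤ c) :
    Z *ᵥ multiplet P c v k = (((k : ℝ) - (c : ℝ) / 2 : ℝ) : ℂ) • multiplet P c v k := by
  rw [multiplet, mulVec_smul, mulVec_smul, H.z_pow, Nat.cast_sub hk]
  push_cast
  module

theorem casimir_multiplet (H : IsHighestWeight Z P c v) (k : ℕ) :
    casimir Z P *ᵥ multiplet P c v k =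
      (((c : ℝ) / 2 * (c / 2 + 1) : ℝ) : ℂ) • multiplet P c v k := by
  rw [multiplet, mulVec_smul, mulVec_smul, H.casimir_pow]
  module

theorem minus_multiplet_succ {k : ℕ} (hk : k < c) : Pᴴ *ᵥ multiplet P c v (k + 1) =
    ((Real.sqrt (((c : ℝ) - k) * (k + 1)) : ℝ) : ℂ) • multiplet P c v k := by
  rw [multiplet, multiplet, mulVec_smul, mulVec_smul, mulVec_mulVec, ← pow_succ',
    show c - (k + 1) + 1 = c - k by omega, ladderCoeff_succ hk]
  push_cast
  module

theorem plus_multiplet (H : IsHighestWeight Z P c v) {k : ℕ} (hk : k ≤ c) :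
    P *ᵥ multiplet P c v k =
      ((Real.sqrt (((c : ℝ) - k) * (k + 1)) : ℝ) : ℂ) • multiplet P c v (k + 1) := by
  rcases hk.eq_or_lt with rfl | hk
  · simp [multiplet, mulVec_smul, H.plus_mulVec]
  obtain ⟨i, rfl⟩ := Nat.exists_eq_add_of_lt hk
  have hi : ((k + i + 1 : ℕ) : ℝ) - k = i + 1 := by push_cast; ring
  have hsq : (((i + 1) * (k + 1) : ℝ) : ℂ) =
      (Real.sqrt ((i + 1) * (k + 1)) : ℝ) * (Real.sqrt ((i + 1) * (k + 1)) : ℝ) := by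
    rw [← Complex.ofReal_mul, Real.mul_self_sqrt (by positivity)]
  rw [multiplet, multiplet, mulVec_smul, mulVec_smul, show k + i + 1 - k = i + 1 by omega,
    show k + i + 1 - (k + 1) = i by omega, H.plus_pow_succ, ladderCoeff_succ hk, hi,
    show ((i : ℂ) + 1) * ((k + i + 1 : ℕ) - i) = (((i + 1) * (k + 1) : ℝ) : ℂ) by push_cast; ring,
    hsq]
  push_cast
  module

theorem minus_multiplet (H : IsHighestWeight Z P c v) {k : ℕ} (hk : k ≤ c) :
    Pᴴ *ᵥ multiplet P c v k =
      ((Real.sqrt (((c : ℝ) - k + 1) * k) : ℝ) : ℂ) • multiplet P c v (k - 1) := by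
  cases k with
  | zero => simp [multiplet, mulVec_smul, ← pow_succ', H.minus_pow_succ_eq_zero]
  | succ k =>
    rw [minus_multiplet_succ hk, Nat.add_sub_cancel]
    push_cast
    ring_nf

theorem star_multiplet_self_dotProduct (H : IsHighestWeight Z P c v) :
    star (multiplet P c v c) ⬝ᵥ multiplet P c v c = 1 := by
  have hpos : 0 < ∑ p, ‖v p‖ ^ 2 := by
    obtain ⟨p, hp⟩ := Function.ne_iff.1 H.ne_zero
    exact Finset.sum_pos' (fun _ _ => by positivity)
      ⟨p, Finset.mem_univ _, pow_pos (norm_pos_iff.2 hp) 2⟩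
  have hself : star v ⬝ᵥ v = ((∑ p, ‖v p‖ ^ 2 : ℝ) : ℂ) := by
    simp [dotProduct, Complex.conj_mul']
  rw [multiplet, ladderCoeff_self, Nat.sub_self, pow_zero, one_mulVec, Complex.ofReal_one, one_smul,
    star_smul, smul_dotProduct, dotProduct_smul, hself, Complex.star_def, Complex.conj_ofReal,
    smul_smul, smul_eq_mul, ← Complex.ofReal_mul, ← Complex.ofReal_mul, ← mul_inv,
    Real.mul_self_sqrt hpos.le, inv_mul_cancel₀ hpos.ne', Complex.ofReal_one]

theorem star_multiplet_dotProduct_self (H : IsHighestWeight Z P c v) {k : ℕ} (hk : k ≤ c) :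
    star (multiplet P c v k) ⬝ᵥ multiplet P c v k = 1 := by
  induction hk using Nat.decreasingInduction with
  | self => exact H.star_multiplet_self_dotProduct
  | of_succ k hk ih =>
    have hadj := star_conjTranspose_mulVec_dotProduct P (multiplet P c v (k + 1))
      (multiplet P c v k)
    rw [minus_multiplet_succ hk, H.plus_multiplet hk.le, star_smul, smul_dotProduct,
      dotProduct_smul, ih, Complex.star_def, Complex.conj_ofReal] at hadj
    have hpos : 0 < ((c : ℝ) - k) * (k + 1) :=
      mul_pos (sub_pos.2 (by exact_mod_cast hk)) (by positivity)
    exact mul_left_cancel₀ (by exact_mod_cast (Real.sqrt_pos.2 hpos).ne') hadj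

theorem plus_mul_multipletMatrix (H : IsHighestWeight Z P c v) :
    P * multipletMatrix P c v = multipletMatrix P c v * spinPlus c := by
  ext p k
  refine (congrFun (H.plus_multiplet k.is_le) p).trans ?_
  rw [Pi.smul_apply, smul_eq_mul, mul_comm, ← sum_mul_spinPlus fun k => multiplet P c v k p]
  rfl

theorem minus_mul_multipletMatrix (H : IsHighestWeight Z P c v) :
    Pᴴ * multipletMatrix P c v = multipletMatrix P c v * spinMinus c := by
  ext p k
  refine (congrFun (H.minus_multiplet k.is_le) p).trans ?_
  rw [Pi.smul_apply, smul_eq_mul, mul_comm, ← sum_mul_spinMinus fun k => multiplet P c v k p]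
  rfl

theorem yComponent_mul_multipletMatrix (H : IsHighestWeight Z P c v) :
    yComponent P * multipletMatrix P c v = multipletMatrix P c v * spinY c :=
  yComponent_mul_eq_mul_yComponent H.plus_mul_multipletMatrix H.minus_mul_multipletMatrix

theorem multipletMatrix_conjTranspose_mul_self (H : IsHighestWeight Z P c v) :
    (multipletMatrix P c v)ᴴ * multipletMatrix P c v = 1 := by
  ext k l
  change star (multiplet P c v k) ⬝ᵥ multiplet P c v l = _
  rcases eq_or_ne k l with rfl | hkl
  · rw [H.star_multiplet_dotProduct_self k.is_le, one_apply_eq]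
  · rw [one_apply_ne hkl]
    refine star_dotProduct_eq_zero_of_isHermitian H.isHermitian (H.z_multiplet k.is_le)
      (H.z_multiplet l.is_le) fun h => hkl (Fin.ext ?_)
    exact_mod_cast sub_left_injective h

theorem multipletMatrix_conjTranspose_mul_of_ne (H : IsHighestWeight Z P c v)
    (H' : IsHighestWeight Z P d w) (hcd : c ≠ d) :
    (multipletMatrix P c v)ᴴ * multipletMatrix P d w = 0 := by
  ext k l
  refine star_dotProduct_eq_zero_of_isHermitian H.casimir_isHermitian (H.casimir_multiplet k)
    (H'.casimir_multiplet l) fun h => hcd ?_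
  have hprod : ((c : ℝ) - d) * (c + d + 2) = 0 := by linear_combination 4 * h
  exact_mod_cast sub_eq_zero.1 ((mul_eq_zero.1 hprod).resolve_right (by positivity))

end IsHighestWeight

end Ladder

/-! ### The states `|J M⟩` and the reduced Wigner functions -/

section Ket

/-- The reduced Wigner function `d^J_{M' M}(β) = ⟨J M'| exp(-iβJ_y) |J M⟩`, with `n = 2J`. -/
def reducedWigner (n : ℕ) (M' M : ℤ) (β : ℝ) : ℂ :=
  star (ket n M') ⬝ᵥ (axisRotation (spinY n) β *ᵥ ket n M)

theorem twoM_injective (n : ℕ) : Function.Injective (twoM n) := by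
  intro k l h
  simp only [twoM] at h
  exact Fin.ext (by omega)

theorem star_ket (n : ℕ) (M : ℤ) : star (ket n M) = ket n M := by
  ext k
  simp only [ket, Pi.star_apply]
  split_ifs <;> simp

theorem ket_twoM {n : ℕ} (k : Fin (n + 1)) : ket n (twoM n k) = Pi.single k 1 := by
  ext l
  simp [ket, Pi.single_apply, (twoM_injective n).eq_iff]

theorem ket_eq_zero {n : ℕ} {M : ℤ} (h : ∀ k, twoM n k ≠ M) : ket n M = 0 := by
  ext k
  simp [ket, h k]

theorem spinZ_mulVec_ket (n : ℕ) (M : ℤ) :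
    spinZ n *ᵥ ket n M = (((M : ℝ) / 2 : ℝ) : ℂ) • ket n M := by
  ext k
  rw [spinZ, mulVec_diagonal]
  simp only [ket, Pi.smul_apply, smul_eq_mul]
  split_ifs with h <;> simp [h]

theorem reducedWigner_twoM {n : ℕ} (k l : Fin (n + 1)) (β : ℝ) :
    reducedWigner n (twoM n k) (twoM n l) β = axisRotation (spinY n) β k l := by
  simp [reducedWigner, ket_twoM]

theorem reducedWigner_eq_zero_left {n : ℕ} {M' : ℤ} (h : ∀ k, twoM n k ≠ M') (M : ℤ) (β : ℝ) :
    reducedWigner n M' M β = 0 := by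
  simp [reducedWigner, ket_eq_zero h]

theorem reducedWigner_eq_zero_right {n : ℕ} {M : ℤ} (h : ∀ k, twoM n k ≠ M) (M' : ℤ) (β : ℝ) :
    reducedWigner n M' M β = 0 := by
  simp [reducedWigner, ket_eq_zero h]

end Ket

/-! ### Tensor products -/

section Tensor

variable {ι κ : Type*}

/-- The tensor product `|v⟩ ⊗ |w⟩`. -/
def tensorVec (v : ι → ℂ) (w : κ → ℂ) : ι × κ → ℂ := fun p => v p.1 * w p.2

theorem star_tensorVec (v : ι → ℂ) (w : κ → ℂ) :
    star (tensorVec v w) = tensorVec (star v) (star w) := by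
  ext p
  simp [tensorVec]

theorem yComponent_kronecker_add [DecidableEq ι] [DecidableEq κ] (P : Matrix ι ι ℂ)
    (Q : Matrix κ κ ℂ) :
    yComponent (P ⊗ₖ 1 + 1 ⊗ₖ Q) = yComponent P ⊗ₖ 1 + 1 ⊗ₖ yComponent Q := by
  rw [yComponent, conjTranspose_add, conjTranspose_kronecker, conjTranspose_kronecker,
    conjTranspose_one, conjTranspose_one]
  ext
  simp only [yComponent, Matrix.smul_apply, Matrix.sub_apply, Matrix.add_apply, kroneckerMap_apply,
    smul_eq_mul]
  ring

variable [Fintype ι] [Fintype κ]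

theorem kronecker_mulVec_tensorVec (A : Matrix ι ι ℂ) (B : Matrix κ κ ℂ) (v : ι → ℂ) (w : κ → ℂ) :
    (A ⊗ₖ B) *ᵥ tensorVec v w = tensorVec (A *ᵥ v) (B *ᵥ w) := by
  ext p
  simp only [mulVec, dotProduct, tensorVec, kroneckerMap_apply, Fintype.sum_prod_type,
    Finset.sum_mul_sum]
  exact Finset.sum_congr rfl fun i _ => Finset.sum_congr rfl fun j _ => by ring

theorem tensorVec_dotProduct_tensorVec (v v' : ι → ℂ) (w w' : κ → ℂ) :
    tensorVec v w ⬝ᵥ tensorVec v' w' = (v ⬝ᵥ v') * (w ⬝ᵥ w') := by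
  simp only [dotProduct, tensorVec, Fintype.sum_prod_type, Finset.sum_mul_sum]
  exact Finset.sum_congr rfl fun i _ => Finset.sum_congr rfl fun j _ => by ring

variable [DecidableEq ι] [DecidableEq κ]

open scoped Matrix.Norms.Operator in
theorem exp_kronecker_one (A : Matrix ι ι ℂ) :
    NormedSpace.exp (A ⊗ₖ (1 : Matrix κ κ ℂ)) = NormedSpace.exp A ⊗ₖ 1 := by
  rw [kronecker_one, kronecker_one, exp_blockDiagonal]
  exact congrArg blockDiagonal (Pi.exp_def fun _ : κ => A)

theorem exp_one_kronecker (B : Matrix κ κ ℂ) :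
    NormedSpace.exp ((1 : Matrix ι ι ℂ) ⊗ₖ B) = 1 ⊗ₖ NormedSpace.exp B := by
  have hswap (C : Matrix κ κ ℂ) : (1 : Matrix ι ι ℂ) ⊗ₖ C =
      (C ⊗ₖ 1).submatrix (Equiv.prodComm ι κ) (Equiv.prodComm ι κ) := by
    ext ⟨i, k⟩ ⟨j, l⟩
    simp [mul_comm]
  rw [hswap, hswap, exp_submatrix_equiv, exp_kronecker_one]

theorem axisRotation_kronecker_add (A : Matrix ι ι ℂ) (B : Matrix κ κ ℂ) (t : ℝ) :
    axisRotation (A ⊗ₖ 1 + 1 ⊗ₖ B) t = axisRotation A t ⊗ₖ axisRotation B t := by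
  have hcomm : Commute (((-Complex.I * (t : ℂ)) • A) ⊗ₖ (1 : Matrix κ κ ℂ))
      ((1 : Matrix ι ι ℂ) ⊗ₖ ((-Complex.I * (t : ℂ)) • B)) := by
    rw [Commute, SemiconjBy, ← mul_kronecker_mul, ← mul_kronecker_mul, Matrix.mul_one,
      Matrix.one_mul, Matrix.mul_one, Matrix.one_mul]
  rw [axisRotation, smul_add, ← smul_kronecker, ← kronecker_smul, exp_add_of_commute _ _ hcomm,
    exp_kronecker_one, exp_one_kronecker, ← mul_kronecker_mul, Matrix.mul_one, Matrix.one_mul]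
  rfl

end Tensor

/-! ### The coupling of two angular momenta -/

section Coupling

variable {a b c : ℕ}

/-- The total raising operator `J_+ ⊗ 1 + 1 ⊗ J_+` on the tensor product of two spins. -/
def coupledPlus (a b : ℕ) : Matrix (Fin (a + 1) × Fin (b + 1)) (Fin (a + 1) × Fin (b + 1)) ℂ :=
  spinPlus a ⊗ₖ 1 + 1 ⊗ₖ spinPlus b

/-- The total `z`-component `J_z ⊗ 1 + 1 ⊗ J_z` on the tensor product of two spins. -/
def coupledZ (a b : ℕ) : Matrix (Fin (a + 1) × Fin (b + 1)) (Fin (a + 1) × Fin (b + 1)) ℂ :=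
  spinZ a ⊗ₖ 1 + 1 ⊗ₖ spinZ b

theorem isAngularMomentum_coupled (a b : ℕ) :
    IsAngularMomentum (coupledZ a b) (coupledPlus a b) :=
  (isAngularMomentum_spin a).kronecker_add (isAngularMomentum_spin b)

theorem coupledPlus_conjTranspose (a b : ℕ) : (coupledPlus a b)ᴴ = coupledMinus a b := by
  simp [coupledPlus, coupledMinus, conjTranspose_kronecker, spinMinus]

theorem coupledPlus_mulVec_apply (f : ℕ → ℕ → ℂ) (p : Fin (a + 1) × Fin (b + 1)) :
    (coupledPlus a b *ᵥ fun q => f q.1 q.2) p =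
      f (p.1 - 1) p.2 * (Real.sqrt (((a : ℝ) - p.1 + 1) * p.1) : ℝ) +
      f p.1 (p.2 - 1) * (Real.sqrt (((b : ℝ) - p.2 + 1) * p.2) : ℝ) := by
  rw [← sum_mul_spinMinus fun k => f k p.2, ← sum_mul_spinMinus fun k => f p.1 k,
    coupledPlus, add_mulVec, Pi.add_apply]
  simp only [spinMinus_apply, mulVec, dotProduct, Fintype.sum_prod_type, kroneckerMap_apply]
  congr 1
  · simp [one_apply, mul_comm]
  · rw [Finset.sum_comm]
    simp [one_apply, mul_comm]

theorem highestVector_apply (p : Fin (a + 1) × Fin (b + 1)) :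
    highestVector a b c p = if 2 * ((p.1 : ℕ) + p.2) = a + b + c then
      (-1) ^ (a - p.1 : ℕ) * ((Real.sqrt (a.factorial * b.factorial) : ℂ) *
        ((ladderCoeff a p.1 : ℂ) * (ladderCoeff b p.2 : ℂ))) else 0 := by
  have hsqrt : Real.sqrt (((p.1 : ℕ).factorial * (p.2 : ℕ).factorial : ℝ) /
      ((a - (p.1 : ℕ)).factorial * (b - (p.2 : ℕ)).factorial)) =
      Real.sqrt (a.factorial * b.factorial) * (ladderCoeff a p.1 * ladderCoeff b p.2) := by
    rw [ladderCoeff, ladderCoeff, ← Real.sqrt_mul (by positivity), ← Real.sqrt_mul (by positivity)]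
    congr 1
    field_simp
  rw [highestVector, hsqrt]
  push_cast
  rfl

theorem coupledPlus_mulVec_highestVector (h : Triangle a b c) :
    coupledPlus a b *ᵥ highestVector a b c = 0 := by
  obtain ⟨-, ha, hb, -⟩ := h
  ext ⟨⟨k, hk⟩, ⟨l, hl⟩⟩
  rw [funext highestVector_apply]
  refine (coupledPlus_mulVec_apply (fun k l => if 2 * (k + l) = a + b + c then
    (-1) ^ (a - k) * ((Real.sqrt (a.factorial * b.factorial) : ℂ) *
      ((ladderCoeff a k : ℂ) * (ladderCoeff b l : ℂ))) else 0) _).trans ?_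
  rw [Pi.zero_apply]
  dsimp only
  cases k with
  | zero =>
    rcases Nat.eq_zero_or_pos l with rfl | hl0
    · simp
    · rw [if_neg (show ¬ 2 * (0 + (l - 1)) = a + b + c by omega)]
      simp
  | succ k =>
    cases l with
    | zero =>
      rw [if_neg (by omega)]
      simp
    | succ l =>
      have hsqrt (n i : ℕ) : ((n : ℝ) - (i + 1 : ℕ) + 1) * (i + 1 : ℕ) = (n - i) * (i + 1) := by
        push_cast
        ring
      rw [hsqrt, hsqrt, Nat.add_sub_cancel, Nat.add_sub_cancel]
      by_cases hc : 2 * (k + 1 + l) = a + b + c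
      · rw [if_pos (by omega), if_pos hc, ladderCoeff_succ (by omega : k < a),
          ladderCoeff_succ (by omega : l < b), show a - k = a - (k + 1) + 1 by omega, pow_succ]
        push_cast
        ring
      · rw [if_neg (by omega), if_neg hc, zero_mul, zero_mul, add_zero]

theorem coupledZ_mulVec_highestVector :
    coupledZ a b *ᵥ highestVector a b c = ((c : ℂ) / 2) • highestVector a b c := by
  have hdiag : coupledZ a b = diagonal fun p => ((twoM a p.1 + twoM b p.2 : ℤ) : ℂ) / 2 := by
    rw [coupledZ, spinZ, spinZ, ← diagonal_one, ← diagonal_one, diagonal_kronecker_diagonal,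
      diagonal_kronecker_diagonal, diagonal_add]
    congr 1
    ext p
    push_cast
    ring
  ext p
  rw [hdiag, mulVec_diagonal, Pi.smul_apply, smul_eq_mul, highestVector]
  split_ifs with hp
  · have hM : twoM a p.1 + twoM b p.2 = c := by
      simp only [twoM]
      omega
    rw [hM, Int.cast_natCast]
  · simp

theorem highestVector_ne_zero (h : Triangle a b c) : highestVector a b c ≠ 0 := by
  obtain ⟨⟨r, hr⟩, ha, -, hc⟩ := h
  refine Function.ne_iff.2 ⟨(⟨a, by omega⟩, ⟨r - a, by omega⟩), ?_⟩
  have hpos : 0 < Real.sqrt ((a.factorial * (r - a).factorial) /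
    ((a - a).factorial * (b - (r - a)).factorial)) := Real.sqrt_pos.2 (by positivity)
  rw [highestVector, if_pos (by dsimp only; omega)]
  exact mul_ne_zero (pow_ne_zero _ (by norm_num)) (by exact_mod_cast hpos.ne')

theorem isHighestWeight_highestVector (h : Triangle a b c) :
    IsHighestWeight (coupledZ a b) (coupledPlus a b) c (highestVector a b c) where
  toIsAngularMomentum := isAngularMomentum_coupled a b
  plus_mulVec := coupledPlus_mulVec_highestVector h
  z_mulVec := coupledZ_mulVec_highestVector
  ne_zero := highestVector_ne_zero h

/-- The matrix whose columns are the coupled states `|(J₁ J₂) J M⟩`, in the order of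
increasing `M`. -/
def coupledMatrix (a b c : ℕ) : Matrix (Fin (a + 1) × Fin (b + 1)) (Fin (c + 1)) ℂ :=
  multipletMatrix (coupledPlus a b) c (highestVector a b c)

theorem coupledKet_eq_multiplet (k : Fin (c + 1)) :
    coupledKet a b c k = multiplet (coupledPlus a b) c (highestVector a b c) k := by
  rw [coupledKet, multiplet, coupledPlus_conjTranspose]
  rfl

/-- The finite set of the `c = 2J` that occur in the coupling of two spins. -/
def couplings (a b : ℕ) : Finset ℕ :=
  (Finset.range (min a b + 1)).image fun i => a + b - 2 * i

theorem mem_couplings : c ∈ couplings a b ↔ Triangle a b c := by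
  simp only [couplings, Finset.mem_image, Finset.mem_range]
  constructor
  · rintro ⟨i, hi, rfl⟩
    refine ⟨⟨a + b - i, ?_⟩, ?_, ?_, ?_⟩ <;> omega
  · rintro ⟨⟨r, hr⟩, ha, hb, hc⟩
    exact ⟨a + b - r, by omega, by omega⟩

theorem sum_couplings_add_one (a b : ℕ) : ∑ c ∈ couplings a b, (c + 1) = (a + 1) * (b + 1) := by
  have hinj : Set.InjOn (fun i => a + b - 2 * i) (Finset.range (min a b + 1)) := by
    intro i hi j hj hij
    simp only [Finset.coe_range, Set.mem_Iio] at hi hj hij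
    omega
  have hpartial (t : ℕ) (ht : t ≤ min a b + 1) :
      ((∑ i ∈ Finset.range t, (a + b - 2 * i + 1) : ℕ) : ℤ) = t * (a + b + 2 - t) := by
    induction t with
    | zero => simp
    | succ t ih =>
      rw [Finset.sum_range_succ, Nat.cast_add, ih (by omega), Nat.cast_add, Nat.cast_sub (by omega)]
      push_cast
      ring
  rw [couplings, Finset.sum_image hinj]
  zify [hpartial _ le_rfl]
  rcases le_total a b with h | h
  · rw [min_eq_left (by exact_mod_cast h)]
    ring
  · rw [min_eq_right (by exact_mod_cast h)]
    ring

/-- The matrix whose columns are all the coupled states of two spins; it is unitary. -/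
def couplingMatrix (a b : ℕ) :
    Matrix (Fin (a + 1) × Fin (b + 1)) (Σ c : couplings a b, Fin (c + 1)) ℂ :=
  of fun p x => coupledMatrix a b x.1 p x.2

theorem couplingMatrix_conjTranspose_mul_self (a b : ℕ) :
    (couplingMatrix a b)ᴴ * couplingMatrix a b = 1 := by
  ext ⟨⟨c, hc⟩, k⟩ ⟨⟨d, hd⟩, l⟩
  change ((coupledMatrix a b c)ᴴ * coupledMatrix a b d) k l = _
  have Hc := isHighestWeight_highestVector (mem_couplings.1 hc)
  have Hd := isHighestWeight_highestVector (mem_couplings.1 hd)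
  rcases eq_or_ne c d with rfl | hcd
  · rw [coupledMatrix, Hc.multipletMatrix_conjTranspose_mul_self, one_apply, one_apply]
    simp
  · rw [coupledMatrix, coupledMatrix, Hc.multipletMatrix_conjTranspose_mul_of_ne Hd hcd, one_apply,
      if_neg (by simp [hcd]), Matrix.zero_apply]

theorem sum_coupledMatrix_mul_conjTranspose (a b : ℕ) :
    ∑ c ∈ couplings a b, coupledMatrix a b c * (coupledMatrix a b c)ᴴ = 1 := by
  have hcard : Fintype.card (Σ c : couplings a b, Fin (c + 1)) =
      Fintype.card (Fin (a + 1) × Fin (b + 1)) := by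
    simp only [Fintype.card_sigma, Fintype.card_fin, Fintype.card_prod]
    rw [Finset.sum_coe_sort (couplings a b) fun c => c + 1, sum_couplings_add_one]
  rw [← (mul_eq_one_comm_of_card_eq _ _ _ hcard).1 (couplingMatrix_conjTranspose_mul_self a b),
    ← Finset.sum_coe_sort]
  ext p q
  rw [Matrix.sum_apply, mul_apply, Fintype.sum_sigma]
  rfl

theorem axisRotation_yComponent_coupledPlus (a b : ℕ) (β : ℝ) :
    axisRotation (yComponent (coupledPlus a b)) β = ∑ c ∈ couplings a b,
      coupledMatrix a b c * axisRotation (spinY c) β * (coupledMatrix a b c)ᴴ := by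
  rw [← Matrix.mul_one (axisRotation _ β), ← sum_coupledMatrix_mul_conjTranspose, Matrix.mul_sum]
  refine Finset.sum_congr rfl fun c hc => ?_
  rw [← Matrix.mul_assoc, coupledMatrix, axisRotation_mul_eq_mul_axisRotation
    (isHighestWeight_highestVector (mem_couplings.1 hc)).yComponent_mul_multipletMatrix]

end Coupling

/-! ### Clebsch–Gordan coefficients and the Clebsch–Gordan series -/

section ClebschGordan

variable {a b c : ℕ}

theorem star_pow_mulVec_of_map_star_eq {ι : Type*} [Fintype ι] [DecidableEq ι] {A : Matrix ι ι ℂ}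
    {v : ι → ℂ} (hA : A.map star = A) (hv : star v = v) (i : ℕ) :
    star (A ^ i *ᵥ v) = A ^ i *ᵥ v := by
  induction i with
  | zero => simpa using hv
  | succ i ih =>
    have hstar (w : ι → ℂ) : star (A *ᵥ w) = A *ᵥ star w := by
      rw [star_mulVec, conjTranspose, transpose_map, hA, vecMul_transpose]
    rw [pow_succ', ← mulVec_mulVec, hstar, ih]

theorem coupledMinus_map_star (a b : ℕ) : (coupledMinus a b).map star = coupledMinus a b := by
  have hspin (n : ℕ) (k l : Fin (n + 1)) : star (spinMinus n k l) = spinMinus n k l := by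
    rw [spinMinus_apply, ← conjTranspose_apply]
    exact spinMinus_apply k l
  ext p q
  simp only [coupledMinus, map_apply, Matrix.add_apply, kroneckerMap_apply, star_add, star_mul',
    hspin, one_apply]
  congr 2 <;> split_ifs <;> simp

theorem star_highestVector (a b c : ℕ) : star (highestVector a b c) = highestVector a b c := by
  ext p
  simp only [highestVector, Pi.star_apply]
  split_ifs <;> simp

theorem star_coupledKet (k : Fin (c + 1)) : star (coupledKet a b c k) = coupledKet a b c k := by
  rw [coupledKet, star_smul, star_smul,
    star_pow_mulVec_of_map_star_eq (coupledMinus_map_star a b) (star_highestVector a b c)]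
  simp

theorem coupledZ_mulVec_tensorVec_ket (M₁ M₂ : ℤ) :
    coupledZ a b *ᵥ tensorVec (ket a M₁) (ket b M₂) =
      ((((M₁ + M₂ : ℤ) : ℝ) / 2 : ℝ) : ℂ) • tensorVec (ket a M₁) (ket b M₂) := by
  rw [coupledZ, add_mulVec, kronecker_mulVec_tensorVec, kronecker_mulVec_tensorVec, one_mulVec,
    one_mulVec, spinZ_mulVec_ket, spinZ_mulVec_ket]
  ext p
  simp only [tensorVec, Pi.add_apply, Pi.smul_apply, smul_eq_mul]
  push_cast
  ring

theorem clebschGordan_of_not_triangle (h : ¬ Triangle a b c) (M₁ M₂ M : ℤ) :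
    clebschGordan a M₁ b M₂ c M = 0 := by
  rw [clebschGordan, if_neg h]

theorem clebschGordan_twoM (h : Triangle a b c) (M₁ M₂ : ℤ) (k : Fin (c + 1)) :
    clebschGordan a M₁ b M₂ c (twoM c k) =
      star (tensorVec (ket a M₁) (ket b M₂)) ⬝ᵥ coupledKet a b c k := by
  rw [clebschGordan, if_pos h, ket_twoM]
  simp only [Pi.single_apply, mul_ite, mul_one, mul_zero, Finset.sum_ite_eq', Finset.mem_univ,
    if_true]
  rfl

theorem clebschGordan_eq_zero {M : ℤ} (h : ∀ k, twoM c k ≠ M) (M₁ M₂ : ℤ) :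
    clebschGordan a M₁ b M₂ c M = 0 := by
  simp [clebschGordan, ket_eq_zero h]

theorem star_clebschGordan (M₁ M₂ M : ℤ) :
    star (clebschGordan a M₁ b M₂ c M) = clebschGordan a M₁ b M₂ c M := by
  by_cases h : Triangle a b c
  · by_cases hM : ∃ k, twoM c k = M
    · obtain ⟨k, rfl⟩ := hM
      rw [clebschGordan_twoM h, ← star_dotProduct_star, star_star, star_coupledKet,
        dotProduct_comm, star_tensorVec, star_ket, star_ket]
    · rw [clebschGordan_eq_zero (not_exists.1 hM), star_zero]
  · rw [clebschGordan_of_not_triangle h, star_zero]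

theorem star_tensorVec_vecMul_coupledMatrix (h : Triangle a b c) (M₁ M₂ : ℤ) :
    star (tensorVec (ket a M₁) (ket b M₂)) ᵥ* coupledMatrix a b c =
      clebschGordan a M₁ b M₂ c (M₁ + M₂) • ket c (M₁ + M₂) := by
  ext k
  rw [Pi.smul_apply, smul_eq_mul]
  change star (tensorVec (ket a M₁) (ket b M₂)) ⬝ᵥ
    multiplet (coupledPlus a b) c (highestVector a b c) k = _
  by_cases hk : twoM c k = M₁ + M₂
  · rw [← hk, clebschGordan_twoM h, ket_twoM, coupledKet_eq_multiplet, Pi.single_eq_same, mul_one]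
  · rw [ket, if_neg hk, mul_zero]
    refine star_dotProduct_eq_zero_of_isHermitian (isAngularMomentum_coupled a b).isHermitian
      (coupledZ_mulVec_tensorVec_ket M₁ M₂)
      ((isHighestWeight_highestVector h).z_multiplet k.is_le) fun hM => hk ?_
    have hM' : ((M₁ + M₂ : ℤ) : ℝ) = ((2 * (k : ℤ) - c : ℤ) : ℝ) := by
      push_cast at hM ⊢
      linarith
    rw [twoM]
    exact_mod_cast hM'.symm

theorem coupledMatrix_conjTranspose_mulVec_tensorVec (h : Triangle a b c) (M₁ M₂ : ℤ) :
    (coupledMatrix a b c)ᴴ *ᵥ tensorVec (ket a M₁) (ket b M₂) =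
      clebschGordan a M₁ b M₂ c (M₁ + M₂) • ket c (M₁ + M₂) := by
  have hstar := congrArg star (star_tensorVec_vecMul_coupledMatrix h M₁ M₂)
  rwa [star_vecMul, star_star, star_smul, star_ket, star_clebschGordan] at hstar

theorem reducedWigner_mul_eq_star_tensorVec_dotProduct (M₁' M₁ M₂' M₂ : ℤ) (β : ℝ) :
    reducedWigner a M₁' M₁ β * reducedWigner b M₂' M₂ β =
      star (tensorVec (ket a M₁') (ket b M₂')) ⬝ᵥ
        (axisRotation (yComponent (coupledPlus a b)) β *ᵥ tensorVec (ket a M₁) (ket b M₂)) := by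
  rw [coupledPlus, yComponent_kronecker_add, axisRotation_kronecker_add,
    kronecker_mulVec_tensorVec, star_tensorVec, tensorVec_dotProduct_tensorVec]
  rfl

theorem reducedWigner_mul_reducedWigner (M₁' M₁ M₂' M₂ : ℤ) (β : ℝ) :
    reducedWigner a M₁' M₁ β * reducedWigner b M₂' M₂ β =
      ∑ c ∈ couplings a b, clebschGordan a M₁' b M₂' c (M₁' + M₂') *
        clebschGordan a M₁ b M₂ c (M₁ + M₂) * reducedWigner c (M₁' + M₂') (M₁ + M₂) β := by
  rw [reducedWigner_mul_eq_star_tensorVec_dotProduct, axisRotation_yComponent_coupledPlus,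
    sum_mulVec, dotProduct_sum]
  refine Finset.sum_congr rfl fun c hc => ?_
  have h := mem_couplings.1 hc
  rw [← mulVec_mulVec, ← mulVec_mulVec, coupledMatrix_conjTranspose_mulVec_tensorVec h,
    dotProduct_mulVec, star_tensorVec_vecMul_coupledMatrix h, mulVec_smul, smul_dotProduct,
    dotProduct_smul, smul_eq_mul, smul_eq_mul, mul_assoc, reducedWigner, star_ket]

end ClebschGordan

/-! ### Symmetries of the reduced Wigner functions -/

section Symmetry

variable {ι : Type*} [Fintype ι] [DecidableEq ι]

theorem axisRotation_conjTranspose {A : Matrix ι ι ℂ} (hA : A.IsHermitian) (t : ℝ) :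
    (axisRotation A t)ᴴ = axisRotation (-A) t := by
  rw [axisRotation, axisRotation, ← exp_conjTranspose, conjTranspose_smul, hA.eq, smul_neg,
    ← neg_smul]
  simp

theorem axisRotation_transpose (A : Matrix ι ι ℂ) (t : ℝ) :
    (axisRotation A t)ᵀ = axisRotation Aᵀ t := by
  rw [axisRotation, axisRotation, ← exp_transpose, transpose_smul]

theorem axisRotation_submatrix (A : Matrix ι ι ℂ) (e : Equiv.Perm ι) (t : ℝ) :
    (axisRotation A t).submatrix e e = axisRotation (A.submatrix e e) t := by
  rw [axisRotation, axisRotation, ← exp_submatrix_equiv]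
  rfl

variable {n : ℕ}

theorem spinY_submatrix_rev (n : ℕ) : (spinY n).submatrix Fin.rev Fin.rev = -spinY n := by
  rw [spinY, submatrix_smul, submatrix_sub]
  simp only [Pi.smul_apply, Pi.sub_apply]
  rw [spinPlus_submatrix_rev, spinMinus_submatrix_rev, ← smul_neg, neg_sub]

theorem spinY_isHermitian (n : ℕ) : (spinY n).IsHermitian :=
  yComponent_isHermitian (spinPlus n)

theorem spinY_transpose (n : ℕ) : (spinY n)ᵀ = -spinY n := by
  ext l k
  simp only [spinY, transpose_apply, Matrix.neg_apply, Matrix.smul_apply, Matrix.sub_apply,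
    spinMinus_apply, smul_eq_mul]
  ring

/-- The diagonal matrix of the signs `(-1)^(J + M)`, the rotation by `π` about the `z`-axis up to
a phase. -/
def spinParity (n : ℕ) : Matrix (Fin (n + 1)) (Fin (n + 1)) ℂ := diagonal fun k => (-1) ^ (k : ℕ)

theorem spinY_mul_spinParity (n : ℕ) : spinY n * spinParity n = spinParity n * -spinY n := by
  ext l k
  rw [spinParity, mul_diagonal, diagonal_mul]
  simp only [spinY, Matrix.neg_apply, Matrix.smul_apply, Matrix.sub_apply, spinMinus_apply,
    spinPlus, of_apply, smul_eq_mul]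
  split_ifs with h h' h'
  · omega
  · rw [h, pow_succ]
    ring
  · rw [h', pow_succ]
    ring
  · simp

theorem star_axisRotation_spinY (k l : Fin (n + 1)) (β : ℝ) :
    star (axisRotation (spinY n) β k l) =
      (-1) ^ (k + l : ℕ) * axisRotation (spinY n) β k.rev l.rev := by
  have hrev : axisRotation (-spinY n) β = (axisRotation (spinY n) β).submatrix Fin.rev Fin.rev := by
    rw [← spinY_submatrix_rev]
    exact (axisRotation_submatrix _ Fin.revPerm β).symm
  have hconj : star (axisRotation (spinY n) β k l) = axisRotation (-spinY n) β l k := by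
    rw [← axisRotation_conjTranspose (spinY_isHermitian n), conjTranspose_apply]
  have htrans : axisRotation (-spinY n) β l k = axisRotation (spinY n) β k l := by
    rw [← spinY_transpose, ← axisRotation_transpose, transpose_apply]
  have hsign := congrFun₂ (axisRotation_mul_eq_mul_axisRotation (spinY_mul_spinParity n) β) k l
  rw [spinParity, mul_diagonal, diagonal_mul, hrev, submatrix_apply] at hsign
  have hl : ((-1 : ℂ) ^ (l : ℕ)) * (-1) ^ (l : ℕ) = 1 := by rw [← mul_pow]; simp
  rw [hconj, htrans, pow_add]
  linear_combination (-1) ^ (l : ℕ) * hsign - axisRotation (spinY n) β k l * hl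

theorem twoM_rev (k : Fin (n + 1)) : twoM n k.rev = -twoM n k := by
  have := k.2
  simp only [twoM, Fin.val_rev]
  omega

theorem star_reducedWigner (k l : Fin (n + 1)) (β : ℝ) :
    star (reducedWigner n (twoM n k) (twoM n l) β) =
      (-1) ^ (k + l : ℕ) * reducedWigner n (-twoM n k) (-twoM n l) β := by
  rw [← twoM_rev, ← twoM_rev, reducedWigner_twoM, reducedWigner_twoM, star_axisRotation_spinY]

end Symmetry

/-! ### Coupling to angular momentum zero -/

section CouplingZero

variable {a b : ℕ}

theorem triangle_zero_iff : Triangle a b 0 ↔ a = b := by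
  constructor
  · rintro ⟨-, hab, hba, -⟩
    omega
  · rintro rfl
    exact ⟨⟨a, by omega⟩, by omega, by omega, by omega⟩

theorem highestVector_self_zero (p : Fin (a + 1) × Fin (a + 1)) :
    highestVector a a 0 p = if p.2 = p.1.rev then (-1) ^ (a - p.1 : ℕ) else 0 := by
  obtain ⟨⟨k, hk⟩, ⟨l, hl⟩⟩ := p
  simp only [highestVector, Fin.ext_iff, Fin.val_rev]
  by_cases h : l = a + 1 - (k + 1)
  · have hk' : a - k = l := by omega
    have hl' : a - l = k := by omega
    rw [if_pos (by omega), if_pos h, hk', hl', mul_comm (l.factorial : ℝ),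
      div_self (by positivity)]
    simp
  · rw [if_neg (by omega), if_neg h]

theorem sum_norm_sq_highestVector_self_zero (a : ℕ) :
    ∑ p, ‖highestVector a a 0 p‖ ^ 2 = (a : ℝ) + 1 := by
  have hnorm (k l : Fin (a + 1)) :
      ‖if l = k.rev then (-1 : ℂ) ^ (a - k : ℕ) else 0‖ ^ 2 = if l = k.rev then (1 : ℝ) else 0 := by
    split_ifs <;> simp
  simp only [highestVector_self_zero, hnorm, Fintype.sum_prod_type]
  simp

theorem tensorVec_single_single {ι κ : Type*} [DecidableEq ι] [DecidableEq κ] (i : ι) (j : κ) :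
    tensorVec (Pi.single i 1) (Pi.single j 1) = Pi.single (i, j) 1 := by
  ext ⟨i', j'⟩
  simp only [tensorVec, Pi.single_apply, Prod.mk.injEq, ite_and, mul_ite, mul_one, mul_zero]
  split_ifs <;> rfl

theorem clebschGordan_self_zero (k : Fin (a + 1)) :
    clebschGordan a (-twoM a k) a (twoM a k) 0 0 = (-1) ^ (k : ℕ) * (Real.sqrt (a + 1) : ℂ)⁻¹ := by
  have hk : a - (a - k) = (k : ℕ) := by omega
  have h := clebschGordan_twoM (triangle_zero_iff.2 (Eq.refl a)) (-twoM a k) (twoM a k) 0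
  rw [show twoM 0 0 = 0 from rfl, ← twoM_rev, ket_twoM, ket_twoM, tensorVec_single_single,
    coupledKet, sum_norm_sq_highestVector_self_zero] at h
  rw [← twoM_rev, h]
  simp [highestVector_self_zero, Fin.val_rev, hk, mul_comm]

end CouplingZero

/-! ### Rotation of operators that transform linearly -/

section TensorOperator

variable {ι κ : Type*} [Fintype ι] [DecidableEq ι] [Fintype κ] [DecidableEq κ]

theorem axisRotation_mul_of_lie_eq_sum {A : Matrix ι ι ℂ} {B : Matrix κ κ ℂ}
    {X : κ → Matrix ι ι ℂ} (h : ∀ k, ⁅A, X k⁆ = ∑ l, B l k • X l) (t : ℝ) (k : κ) :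
    axisRotation A t * X k = ∑ l, axisRotation B t l k • (X l * axisRotation A t) := by
  -- The block row of the operators `X l` intertwines `A` with `A ⊗ 1 + 1 ⊗ B`.
  let U : Matrix ι (ι × κ) ℂ := of fun i p => X p.2 i p.1
  have mul_apply_pair (C : Matrix ι ι ℂ) (D : Matrix κ κ ℂ) (i j : ι) (k : κ) :
      (U * C ⊗ₖ D) i (j, k) = (∑ l, D l k • (X l * C)) i j := by
    simp only [mul_apply, Fintype.sum_prod_type, kroneckerMap_apply, U, of_apply, Matrix.sum_apply,
      Matrix.smul_apply, smul_eq_mul, Finset.mul_sum]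
    rw [Finset.sum_comm]
    exact Finset.sum_congr rfl fun l _ => Finset.sum_congr rfl fun i' _ => by ring
  have hU : A * U = U * (A ⊗ₖ 1 + 1 ⊗ₖ B) := by
    ext i ⟨j, k⟩
    have hk : A * X k = X k * A + ∑ l, B l k • X l := by
      rw [← h k, Ring.lie_def]
      abel
    rw [Matrix.mul_add, Matrix.add_apply, mul_apply_pair, mul_apply_pair]
    simpa [one_apply] using (show (A * U) i (j, k) = _ from congrFun₂ hk i j)
  ext i j
  rw [← mul_apply_pair, ← axisRotation_kronecker_add, ← axisRotation_mul_eq_mul_axisRotation hU]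
  rfl

theorem axisRotation_mul_of_lie_eq_smul {A X : Matrix ι ι ℂ} {μ : ℂ} (h : ⁅A, X⁆ = μ • X) (t : ℝ) :
    axisRotation A t * X = Complex.exp (-Complex.I * t * μ) • (X * axisRotation A t) := by
  have hone : (diagonal fun _ => μ : Matrix Unit Unit ℂ) *ᵥ 1 = μ • 1 := by
    ext
    simp [mulVec_diagonal]
  have hexp := congrFun (axisRotation_mulVec_of_mulVec_eq_smul hone t) ()
  have hrot := axisRotation_mul_of_lie_eq_sum (B := (diagonal fun _ => μ : Matrix Unit Unit ℂ))
    (X := fun _ => X) (by simpa using h) t ()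
  rw [hrot, Fintype.sum_unique]
  congr 1
  simpa [mulVec, dotProduct] using hexp

open scoped Matrix.Norms.Operator in
theorem hasDerivAt_dotProduct_axisRotation_mulVec (A : Matrix ι ι ℂ) (u w : ι → ℂ) (t : ℝ) :
    HasDerivAt (fun t => u ⬝ᵥ (axisRotation A t *ᵥ w))
      (-Complex.I * (u ⬝ᵥ (A *ᵥ (axisRotation A t *ᵥ w)))) t := by
  let entry : Matrix ι ι ℂ →ₗ[ℝ] ℂ :=
    { toFun X := u ⬝ᵥ (X *ᵥ w)
      map_add' X X' := by rw [add_mulVec, dotProduct_add]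
      map_smul' r X := by rw [smul_mulVec, dotProduct_smul, RingHom.id_apply] }
  have hsmul (t : ℝ) : (-Complex.I * t) • A = t • (-Complex.I • A) := by
    rw [mul_comm, mul_smul, Complex.coe_smul]
  have hrot : HasDerivAt (axisRotation A) ((-Complex.I • A) * axisRotation A t) t := by
    simpa only [← hsmul] using! hasDerivAt_exp_smul_const' (𝕂 := ℝ) (-Complex.I • A) t
  have hentry := (LinearMap.toContinuousLinearMap entry).hasFDerivAt.comp_hasDerivAt t hrot
  rw [mulVec_mulVec, ← smul_eq_mul, ← dotProduct_smul, ← smul_mulVec, ← Matrix.smul_mul]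
  exact hentry

end TensorOperator

/-! ### Integrals of the reduced Wigner functions -/

section Integral

variable {ι : Type*}

/-- The component `J_x = (J_+ + J_-) / 2` of the angular momentum with raising operator `P`. -/
def xComponent (P : Matrix ι ι ℂ) : Matrix ι ι ℂ := (1 / 2 : ℂ) • (P + Pᴴ)

theorem yComponent_eq (P : Matrix ι ι ℂ) : yComponent P = (-Complex.I / 2) • (P - Pᴴ) := by
  rw [yComponent]
  congr 1
  field_simp
  simp

namespace IsAngularMomentum

variable [Fintype ι] {Z P : Matrix ι ι ℂ}

theorem lie_z_x (H : IsAngularMomentum Z P) : ⁅Z, xComponent P⁆ = Complex.I • yComponent P := by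
  have hplus := H.lie_plus
  have hminus := H.lie_minus
  rw [Ring.lie_def] at hplus hminus ⊢
  have hI : Complex.I * (-Complex.I / 2) = 1 / 2 := by linear_combination -Complex.I_sq / 2
  simp only [xComponent, yComponent_eq, Matrix.smul_mul, Matrix.mul_smul, Matrix.add_mul,
    Matrix.mul_add, smul_smul, hI]
  linear_combination (norm := module) (1 / 2 : ℂ) • hplus + (1 / 2 : ℂ) • hminus

theorem lie_y_z (H : IsAngularMomentum Z P) : ⁅yComponent P, Z⁆ = Complex.I • xComponent P := by
  have hplus := H.lie_plus
  have hminus := H.lie_minus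
  rw [Ring.lie_def] at hplus hminus ⊢
  simp only [xComponent, yComponent_eq, Matrix.smul_mul, Matrix.mul_smul, Matrix.sub_mul,
    Matrix.mul_sub]
  linear_combination (norm := module) (Complex.I / 2) • hplus - (Complex.I / 2) • hminus

theorem lie_y_x (H : IsAngularMomentum Z P) : ⁅yComponent P, xComponent P⁆ = -Complex.I • Z := by
  have h := H.lie_plus_minus
  rw [Ring.lie_def] at h ⊢
  simp only [xComponent, yComponent_eq, Matrix.smul_mul, Matrix.mul_smul, Matrix.sub_mul,
    Matrix.mul_sub, Matrix.add_mul, Matrix.mul_add]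
  linear_combination (norm := module) (-Complex.I / 2) • h

theorem casimir_eq (H : IsAngularMomentum Z P) :
    casimir Z P = xComponent P * xComponent P + yComponent P * yComponent P + Z * Z := by
  have h := H.lie_plus_minus
  rw [Ring.lie_def] at h
  have hI : -Complex.I / 2 * (-Complex.I / 2) = -1 / 4 := by linear_combination Complex.I_sq / 4
  rw [casimir, yComponent_eq, xComponent, smul_mul_smul_comm, smul_mul_smul_comm, hI]
  simp only [Matrix.sub_mul, Matrix.mul_sub, Matrix.add_mul, Matrix.mul_add]
  linear_combination (norm := module) (-1 / 2 : ℂ) • h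

variable [DecidableEq ι]

theorem axisRotation_y_mul_z (H : IsAngularMomentum Z P) (β : ℝ) :
    axisRotation (yComponent P) β * Z =
      ((Real.cos β : ℂ) • Z + (Real.sin β : ℂ) • xComponent P) * axisRotation (yComponent P) β := by
  -- `Z ± iX` are eigenvectors of the adjoint action of `Y`, with the eigenvalues `±1`.
  have heigen {ε : ℂ} (hε : ε * ε = 1) : ⁅yComponent P, Z + (ε * Complex.I) • xComponent P⁆ =
      ε • (Z + (ε * Complex.I) • xComponent P) := by
    have hz := H.lie_y_z
    have hx := H.lie_y_x
    have hI : ε * Complex.I * -Complex.I = ε := by linear_combination -ε * Complex.I_sq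
    rw [Ring.lie_def] at hz hx ⊢
    rw [Matrix.mul_add, Matrix.add_mul, Matrix.mul_smul, Matrix.smul_mul, add_sub_add_comm,
      ← smul_sub, hz, hx, smul_smul, hI, smul_add, smul_smul, ← mul_assoc, hε, one_mul, add_comm]
  have hplus := axisRotation_mul_of_lie_eq_smul (heigen (ε := 1) (by norm_num)) β
  have hminus := axisRotation_mul_of_lie_eq_smul (heigen (ε := -1) (by norm_num)) β
  have hexp : Complex.exp (-Complex.I * β * 1) = Complex.cos β - Complex.sin β * Complex.I := by
    rw [show -Complex.I * β * 1 = -(β : ℂ) * Complex.I by ring, Complex.exp_mul_I, Complex.cos_neg,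
      Complex.sin_neg, neg_mul, sub_eq_add_neg]
  have hexp' : Complex.exp (-Complex.I * β * -1) = Complex.cos β + Complex.sin β * Complex.I := by
    rw [show -Complex.I * β * -1 = (β : ℂ) * Complex.I by ring, Complex.exp_mul_I]
  rw [hexp] at hplus
  rw [hexp'] at hminus
  have hI : (Complex.sin β * Complex.I) * Complex.I = - Complex.sin β := by
    rw [mul_assoc, Complex.I_mul_I, mul_neg_one]
  simp only [Matrix.mul_add, Matrix.mul_smul, Matrix.smul_mul, smul_add, smul_smul, one_mul,
    sub_mul, add_mul, mul_neg, neg_mul, sub_smul, add_smul, hI] at hplus hminus ⊢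
  rw [Complex.ofReal_cos, Complex.ofReal_sin]
  linear_combination (norm := module) (1 / 2 : ℂ) • hplus + (1 / 2 : ℂ) • hminus

theorem hasDerivAt_sin_mul_yComponent (H : IsAngularMomentum Z P) {u w : ι → ℂ}
    (hu : u ᵥ* Z = 0) (hw : Z *ᵥ w = 0) (β : ℝ) :
    HasDerivAt (fun β : ℝ => (Real.sin β : ℂ) *
        (u ⬝ᵥ (yComponent P *ᵥ (axisRotation (yComponent P) β *ᵥ w))))
      (-Complex.I * ((Real.sin β : ℂ) *
        (u ⬝ᵥ (casimir Z P *ᵥ (axisRotation (yComponent P) β *ᵥ w))))) β := by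
  set E := axisRotation (yComponent P) β with hE
  have hy : u ᵥ* yComponent P = Complex.I • (u ᵥ* xComponent P ᵥ* Z) := by
    have h := congrArg (fun A => -Complex.I • (u ᵥ* A)) H.lie_z_x
    simp only [Ring.lie_def, vecMul_sub, vecMul_smul, ← vecMul_vecMul, hu, zero_vecMul, zero_sub,
      smul_smul, neg_mul, Complex.I_mul_I, neg_neg, one_smul, smul_neg, neg_smul] at h
    exact h.symm
  have hz : (Real.cos β : ℂ) • (Z *ᵥ (E *ᵥ w)) =
      -((Real.sin β : ℂ) • (xComponent P *ᵥ (E *ᵥ w))) := by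
    have h := congrArg (· *ᵥ w) (H.axisRotation_y_mul_z β)
    simp only [← mulVec_mulVec, hw, mulVec_zero, add_mulVec, smul_mulVec] at h
    exact eq_neg_of_add_eq_zero_left h.symm
  have hcos : (Real.cos β : ℂ) * (u ⬝ᵥ (yComponent P *ᵥ (E *ᵥ w))) =
      -Complex.I * ((Real.sin β : ℂ) * (u ⬝ᵥ (xComponent P *ᵥ (xComponent P *ᵥ (E *ᵥ w))))) := by
    rw [dotProduct_mulVec, hy, smul_dotProduct, ← dotProduct_mulVec, smul_eq_mul, mul_left_comm,
      ← smul_eq_mul (Real.cos β : ℂ), ← dotProduct_smul, hz, dotProduct_neg, dotProduct_smul,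
      ← dotProduct_mulVec, smul_eq_mul]
    ring
  have hcasimir : u ⬝ᵥ (casimir Z P *ᵥ (E *ᵥ w)) =
      u ⬝ᵥ (xComponent P *ᵥ (xComponent P *ᵥ (E *ᵥ w))) +
        u ⬝ᵥ (yComponent P *ᵥ (yComponent P *ᵥ (E *ᵥ w))) := by
    simp only [H.casimir_eq, add_mulVec, ← mulVec_mulVec, dotProduct_add]
    rw [dotProduct_mulVec u Z, hu, zero_dotProduct, add_zero]
  have hsin := (Real.hasDerivAt_sin β).ofReal_comp
  have hder := hasDerivAt_dotProduct_axisRotation_mulVec (yComponent P) (u ᵥ* yComponent P) w β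
  simp only [← dotProduct_mulVec] at hder
  refine (hsin.mul hder).congr_deriv ?_
  rw [← hE, hcos, hcasimir]
  ring

theorem integral_sin_mul_casimir_eq_zero (H : IsAngularMomentum Z P) {u w : ι → ℂ}
    (hu : u ᵥ* Z = 0) (hw : Z *ᵥ w = 0) :
    ∫ β in (0 : ℝ)..Real.pi, (Real.sin β : ℂ) *
      (u ⬝ᵥ (casimir Z P *ᵥ (axisRotation (yComponent P) β *ᵥ w))) = 0 := by
  have hintegral := intervalIntegral.integral_eq_sub_of_hasDerivAt (a := 0) (b := Real.pi)
    (fun β _ => H.hasDerivAt_sin_mul_yComponent hu hw β)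
    (Continuous.intervalIntegrable (by fun_prop) 0 Real.pi)
  simpa using hintegral

end IsAngularMomentum

@[fun_prop]
theorem continuous_reducedWigner (n : ℕ) (M' M : ℤ) : Continuous (reducedWigner n M' M) := by
  unfold reducedWigner
  fun_prop

theorem casimir_spin (n : ℕ) :
    casimir (spinZ n) (spinPlus n) = ((n : ℂ) / 2 * (n / 2 + 1)) • 1 := by
  change spinMinus n * spinPlus n + spinZ n * spinZ n + spinZ n = _
  rw [spinMinus_mul_spinPlus, spinZ, diagonal_mul_diagonal, diagonal_add, diagonal_add,
    smul_one_eq_diagonal]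
  congr 1
  ext k
  push_cast [twoM]
  ring

theorem reducedWigner_zero (β : ℝ) : reducedWigner 0 0 0 β = 1 := by
  have hY : spinY 0 = 0 := by
    ext k l
    obtain rfl : k = l := Fin.ext (by omega)
    simp [spinY, spinMinus_apply]
  have h := reducedWigner_twoM (n := 0) 0 0 β
  rwa [hY, axisRotation, smul_zero, NormedSpace.exp_zero, one_apply_eq] at h

theorem integral_sin_mul_reducedWigner_zero_zero (n : ℕ) :
    ∫ β in (0 : ℝ)..Real.pi, (Real.sin β : ℂ) * reducedWigner n 0 0 β = if n = 0 then 2 else 0 := by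
  split_ifs with hn
  · simp only [hn, reducedWigner_zero, mul_one, intervalIntegral.integral_ofReal]
    norm_num
  · have hw : spinZ n *ᵥ ket n 0 = 0 := by simpa using spinZ_mulVec_ket n 0
    have hu : star (ket n 0) ᵥ* spinZ n = 0 := by
      simpa using star_vecMul_eq_smul_of_isHermitian (spinZ_isHermitian n) (spinZ_mulVec_ket n 0)
    have h := (isAngularMomentum_spin n).integral_sin_mul_casimir_eq_zero hu hw
    simp only [casimir_spin, smul_mulVec, one_mulVec, dotProduct_smul, smul_eq_mul,
      ← spinY_eq_yComponent, mul_left_comm _ ((n : ℂ) / 2 * (n / 2 + 1)),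
      intervalIntegral.integral_const_mul] at h
    refine (mul_eq_zero.1 h).resolve_left (mul_ne_zero (by simpa using hn) ?_)
    exact ne_of_apply_ne Complex.re (by simpa using (by positivity : (n : ℝ) / 2 + 1 ≠ 0))

theorem integral_sin_mul_star_reducedWigner_mul {a : ℕ} (b : ℕ) (k l : Fin (a + 1)) :
    ∫ β in (0 : ℝ)..Real.pi, (Real.sin β : ℂ) *
        (star (reducedWigner a (twoM a k) (twoM a l) β) *
          reducedWigner b (twoM a k) (twoM a l) β) =
      if a = b then 2 / ((a : ℂ) + 1) else 0 := by
  have hsum (β : ℝ) : (Real.sin β : ℂ) * (star (reducedWigner a (twoM a k) (twoM a l) β) *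
      reducedWigner b (twoM a k) (twoM a l) β) =
      ∑ c ∈ couplings a b, ((-1) ^ (k + l : ℕ) *
        clebschGordan a (-twoM a k) b (twoM a k) c 0 *
          clebschGordan a (-twoM a l) b (twoM a l) c 0) *
        ((Real.sin β : ℂ) * reducedWigner c 0 0 β) := by
    rw [star_reducedWigner, mul_assoc, reducedWigner_mul_reducedWigner, Finset.mul_sum,
      Finset.mul_sum]
    refine Finset.sum_congr rfl fun c _ => ?_
    rw [neg_add_cancel, neg_add_cancel]
    ring
  simp only [hsum]
  rw [intervalIntegral.integral_finsetSum
    fun c _ => Continuous.intervalIntegrable (by fun_prop) 0 Real.pi]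
  simp only [intervalIntegral.integral_const_mul, integral_sin_mul_reducedWigner_zero_zero, mul_ite,
    mul_zero, Finset.sum_ite_eq', mem_couplings, triangle_zero_iff]
  split_ifs with hab
  · subst hab
    have hsign (i : ℕ) : ((-1 : ℂ) ^ i) * (-1) ^ i = 1 := by rw [← mul_pow]; simp
    have hsqrt : ((Real.sqrt (a + 1) : ℝ) : ℂ) * (Real.sqrt (a + 1) : ℝ) = a + 1 := by
      exact_mod_cast Real.mul_self_sqrt (by positivity : (0 : ℝ) ≤ a + 1)
    rw [clebschGordan_self_zero, clebschGordan_self_zero, pow_add, ← hsqrt, div_eq_mul_inv, mul_inv]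
    linear_combination 2 * (√(a + 1) : ℂ)⁻¹ * (√(a + 1) : ℂ)⁻¹ *
      ((-1) ^ (l : ℕ) * (-1) ^ (l : ℕ) * hsign k + hsign l)
  · rfl

end Integral

/-! ### Canonical anticommutation relations -/

section Anticommutation

variable {ι : Type*} [LinearOrder ι]

/-- The sign `(-1)^n` picked up by `a_i†` and `a_i`, where `n` is the number of occupied modes
before `i`. -/
def fermiSign (i : ι) (T : Finset ι) : ℂ := (-1) ^ (T.filter (· < i)).card

theorem fermiSign_mul_self (i : ι) (T : Finset ι) : fermiSign i T * fermiSign i T = 1 := by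
  simp [fermiSign, ← mul_pow]

theorem fermiSign_insert {i j : ι} {T : Finset ι} (hi : i ∉ T) :
    fermiSign j (insert i T) = (if i < j then -1 else 1) * fermiSign j T := by
  rw [fermiSign, fermiSign, Finset.filter_insert]
  split_ifs
  · rw [Finset.card_insert_of_notMem (by simp [hi]), pow_succ']
  · rw [one_mul]

theorem fermiSign_erase {i j : ι} {T : Finset ι} (hi : i ∈ T) :
    fermiSign j (T.erase i) = (if i < j then -1 else 1) * fermiSign j T := by
  conv_rhs => rw [← Finset.insert_erase hi, fermiSign_insert (Finset.notMem_erase i T)]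
  split_ifs <;> simp

/-- The vector `v` is a superposition of states in which exactly `n` modes are occupied. -/
def HasParticleNumber (n : ℕ) (v : Finset ι → ℂ) : Prop := ∀ T, v T ≠ 0 → T.card = n

theorem hasParticleNumber_vacuum : HasParticleNumber 0 (vacuum ι) := by
  intro T hT
  by_contra hcard
  exact hT (by simp [vacuum, Finset.card_eq_zero.not.1 hcard])

variable [Fintype ι]

theorem HasParticleNumber.eq_smul_vacuum {v : Finset ι → ℂ} (hv : HasParticleNumber 0 v) :
    v = (star (vacuum ι) ⬝ᵥ v) • vacuum ι := by
  ext T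
  by_cases hT : T = ∅
  · simp [vacuum, hT]
  · have hvT : v T = 0 := by
      by_contra hne
      exact hT (Finset.card_eq_zero.1 (hv T hne))
    simp [vacuum, hT, hvT]

theorem create_mulVec (i : ι) (v : Finset ι → ℂ) (T : Finset ι) :
    (create i *ᵥ v) T = if i ∈ T then fermiSign i T * v (T.erase i) else 0 := by
  simp only [Matrix.mulVec, dotProduct, create, Matrix.of_apply]
  split_ifs with hi
  · have hsign : fermiSign i (T.erase i) = fermiSign i T := by simp [fermiSign_erase hi]
    rw [Finset.sum_eq_single (T.erase i), ← hsign]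
    · simp [Finset.insert_erase hi, fermiSign]
    · intro T' _ hT'
      rw [if_neg, zero_mul]
      rintro ⟨hi', rfl⟩
      exact hT' (Finset.erase_insert hi').symm
    · simp
  · refine Finset.sum_eq_zero fun T' _ => ?_
    rw [if_neg, zero_mul]
    rintro ⟨-, rfl⟩
    exact hi (Finset.mem_insert_self i T')

theorem create_conjTranspose_mulVec (i : ι) (v : Finset ι → ℂ) (T : Finset ι) :
    ((create i)ᴴ *ᵥ v) T = if i ∈ T then 0 else fermiSign i T * v (insert i T) := by
  simp only [Matrix.mulVec, dotProduct, create, Matrix.of_apply, Matrix.conjTranspose_apply]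
  split_ifs with hi
  · simp [hi]
  · rw [Finset.sum_eq_single (insert i T)]
    · simp [hi, fermiSign]
    · intro T' _ hT'
      simp [hT']
    · simp

theorem create_mul_create (i j : ι) : create i * create j = -(create j * create i) := by
  refine Matrix.mulVec_injective (funext fun v => funext fun T => ?_)
  rw [Matrix.neg_mulVec, ← Matrix.mulVec_mulVec, ← Matrix.mulVec_mulVec, Pi.neg_apply]
  simp only [create_mulVec, Finset.mem_erase]
  by_cases hij : i ∈ T ∧ j ∈ T
  · obtain ⟨hi, hj⟩ := hij
    rcases lt_trichotomy i j with h | rfl | h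
    · simp [hi, hj, h.ne, h.ne', fermiSign_erase, h, h.not_gt, Finset.erase_right_comm (a := i),
        mul_left_comm]
    · simp
    · simp [hi, hj, h.ne, h.ne', fermiSign_erase, h, h.not_gt, Finset.erase_right_comm (a := i),
        mul_left_comm]
  · rcases not_and_or.1 hij with hi | hj <;> simp [*]

theorem create_conjTranspose_mul_create_self (i : ι) :
    (create i)ᴴ * create i = 1 - create i * (create i)ᴴ := by
  refine Matrix.mulVec_injective (funext fun v => funext fun T => ?_)
  rw [Matrix.sub_mulVec, ← Matrix.mulVec_mulVec, ← Matrix.mulVec_mulVec, Pi.sub_apply]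
  simp only [create_mulVec, create_conjTranspose_mulVec]
  by_cases hi : i ∈ T
  · simp [hi, fermiSign_erase, ← mul_assoc, fermiSign_mul_self]
  · simp [hi, fermiSign_insert, ← mul_assoc, fermiSign_mul_self]

theorem create_conjTranspose_mul_create_of_ne {i j : ι} (hij : i ≠ j) :
    (create i)ᴴ * create j = -(create j * (create i)ᴴ) := by
  refine Matrix.mulVec_injective (funext fun v => funext fun T => ?_)
  rw [Matrix.neg_mulVec, ← Matrix.mulVec_mulVec, ← Matrix.mulVec_mulVec, Pi.neg_apply]
  simp only [create_mulVec, create_conjTranspose_mulVec, Finset.mem_erase, Finset.mem_insert]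
  by_cases hT : i ∉ T ∧ j ∈ T
  · obtain ⟨hi, hj⟩ := hT
    rw [Finset.erase_insert_of_ne hij]
    rcases lt_or_gt_of_ne hij with h | h <;>
      simp [hi, hj, hij, hij.symm, fermiSign_erase, fermiSign_insert, h, h.not_gt, mul_left_comm]
  · rcases not_and_or.1 hT with hi | hj
    · simp [not_not.1 hi, hij]
    · simp [hj, hij.symm]

theorem create_conjTranspose_mulVec_vacuum (i : ι) : (create i)ᴴ *ᵥ vacuum ι = 0 := by
  ext T
  simp [create_conjTranspose_mulVec, vacuum]

theorem HasParticleNumber.create_mulVec {n : ℕ} {v : Finset ι → ℂ} (hv : HasParticleNumber n v)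
    (i : ι) : HasParticleNumber (n + 1) (create i *ᵥ v) := by
  intro T hT
  rw [_root_.create_mulVec] at hT
  split_ifs at hT with hi
  · rw [← hv _ (right_ne_zero_of_mul hT), Finset.card_erase_add_one hi]
  · exact absurd rfl hT

theorem HasParticleNumber.create_conjTranspose_mulVec {n : ℕ} {v : Finset ι → ℂ}
    (hv : HasParticleNumber (n + 1) v) (i : ι) : HasParticleNumber n ((create i)ᴴ *ᵥ v) := by
  intro T hT
  rw [_root_.create_conjTranspose_mulVec] at hT
  split_ifs at hT with hi
  · exact absurd rfl hT
  · exact Nat.succ_injective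
      ((Finset.card_insert_of_notMem hi).symm.trans (hv _ (right_ne_zero_of_mul hT)))

end Anticommutation

/-! ### Second quantization -/

theorem lie_mul_eq {R : Type*} [NonUnitalRing R] (z x y : R) :
    ⁅z, x * y⁆ = ⁅z, x⁆ * y + x * ⁅z, y⁆ := by
  simp only [Ring.lie_def]
  noncomm_ring

section SecondQuantization

variable {N : Type*} (S : Finset (Shell N)) [LinearOrder (Mode S)]

theorem createIn_mul_createIn (s t : S) (k : Fin (s.1.twoJ + 1)) (l : Fin (t.1.twoJ + 1)) :
    createIn S s k * createIn S t l = -(createIn S t l * createIn S s k) :=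
  create_mul_create _ _

theorem annihilateIn_mul_createIn_self (s : S) (k l : Fin (s.1.twoJ + 1)) :
    annihilateIn S s k * createIn S s l =
      (if k = l then 1 else 0) - createIn S s l * annihilateIn S s k := by
  split_ifs with hkl
  · subst hkl
    exact create_conjTranspose_mul_create_self _
  · rw [zero_sub]
    exact create_conjTranspose_mul_create_of_ne
      fun hmode => hkl (eq_of_heq (Sigma.mk.inj hmode).2)

theorem annihilateIn_mul_createIn_of_ne {s t : S} (hst : s ≠ t) (k : Fin (s.1.twoJ + 1))
    (l : Fin (t.1.twoJ + 1)) :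
    annihilateIn S s k * createIn S t l = -(createIn S t l * annihilateIn S s k) :=
  create_conjTranspose_mul_create_of_ne fun hmode => hst (Sigma.mk.inj hmode).1

theorem lie_createIn_mul_annihilateIn_createIn_self (s : S) (l k x : Fin (s.1.twoJ + 1)) :
    ⁅createIn S s l * annihilateIn S s k, createIn S s x⁆ =
      (if k = x then 1 else 0 : ℂ) • createIn S s l := by
  rw [Ring.lie_def, mul_assoc, annihilateIn_mul_createIn_self, ← mul_assoc (createIn S s x),
    createIn_mul_createIn S s s x l]
  split_ifs <;> simp [mul_sub, mul_assoc]

theorem lie_createIn_mul_annihilateIn_createIn_of_ne {s t : S} (hst : s ≠ t)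
    (l k : Fin (s.1.twoJ + 1)) (x : Fin (t.1.twoJ + 1)) :
    ⁅createIn S s l * annihilateIn S s k, createIn S t x⁆ = 0 := by
  rw [Ring.lie_def, mul_assoc, annihilateIn_mul_createIn_of_ne S hst, ← mul_assoc (createIn S t x),
    createIn_mul_createIn S t s x l]
  simp [mul_assoc]

theorem lie_secondQuantized_createIn (A : (n : ℕ) → Matrix (Fin (n + 1)) (Fin (n + 1)) ℂ) (s : S)
    (x : Fin (s.1.twoJ + 1)) :
    ⁅secondQuantized S A, createIn S s x⁆ = ∑ l, A s.1.twoJ l x • createIn S s l := by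
  simp only [secondQuantized, Ring.lie_def, Matrix.sum_mul, Matrix.mul_sum, Matrix.smul_mul,
    Matrix.mul_smul, ← Finset.sum_sub_distrib, ← smul_sub]
  simp only [← Ring.lie_def]
  rw [Finset.sum_eq_single s]
  · simp [lie_createIn_mul_annihilateIn_createIn_self]
  · intro t _ hts
    simp [lie_createIn_mul_annihilateIn_createIn_of_ne S hts]
  · simp

theorem secondQuantized_mulVec_vacuum (A : (n : ℕ) → Matrix (Fin (n + 1)) (Fin (n + 1)) ℂ) :
    secondQuantized S A *ᵥ vacuum (Mode S) = 0 := by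
  have annihilateIn_mulVec_vacuum (s : S) (k : Fin (s.1.twoJ + 1)) :
      annihilateIn S s k *ᵥ vacuum (Mode S) = 0 :=
    create_conjTranspose_mulVec_vacuum _
  simp [secondQuantized, Matrix.sum_mulVec, Matrix.smul_mulVec, ← Matrix.mulVec_mulVec,
    annihilateIn_mulVec_vacuum]

theorem secondQuantized_isHermitian {A : (n : ℕ) → Matrix (Fin (n + 1)) (Fin (n + 1)) ℂ}
    (hA : ∀ n, (A n).IsHermitian) : (secondQuantized S A).IsHermitian := by
  simp only [Matrix.IsHermitian, secondQuantized, Matrix.conjTranspose_sum,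
    Matrix.conjTranspose_smul, Matrix.conjTranspose_mul, annihilateIn,
    Matrix.conjTranspose_conjTranspose, (hA _).apply]
  exact Finset.sum_congr rfl fun s _ => Finset.sum_comm

theorem axisRotation_secondQuantized_mulVec_vacuum
    (A : (n : ℕ) → Matrix (Fin (n + 1)) (Fin (n + 1)) ℂ) (t : ℝ) :
    axisRotation (secondQuantized S A) t *ᵥ vacuum (Mode S) = vacuum (Mode S) := by
  have hzero : secondQuantized S A *ᵥ vacuum (Mode S) = (0 : ℂ) • vacuum (Mode S) := by
    rw [secondQuantized_mulVec_vacuum, zero_smul]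
  simpa using axisRotation_mulVec_of_mulVec_eq_smul hzero t

/-! ### Products of creation operators in a shell -/

theorem creator_zero (s : S) (m : Fin 0 → Fin (s.1.twoJ + 1)) : creator S s m = 1 := by
  simp [creator]

theorem creator_succ (s : S) {p : ℕ} (m : Fin (p + 1) → Fin (s.1.twoJ + 1)) :
    creator S s m = createIn S s (m 0) * creator S s (Fin.tail m) := by
  simp [creator, List.ofFn_succ, Fin.tail]

theorem totalTwoM_succ {n p : ℕ} (m : Fin (p + 1) → Fin (n + 1)) :
    totalTwoM m = twoM n (m 0) + totalTwoM (Fin.tail m) :=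
  Fin.sum_univ_succ _

theorem lie_secondQuantized_spinZ_creator (s : S) {p : ℕ} (m : Fin p → Fin (s.1.twoJ + 1)) :
    ⁅secondQuantized S spinZ, creator S s m⁆ = ((totalTwoM m : ℂ) / 2) • creator S s m := by
  induction p with
  | zero => simp [creator_zero, totalTwoM, Ring.lie_def]
  | succ p ih =>
    have hfirst : ⁅secondQuantized S spinZ, createIn S s (m 0)⁆ =
        ((twoM s.1.twoJ (m 0) : ℂ) / 2) • createIn S s (m 0) := by
      rw [lie_secondQuantized_createIn, Finset.sum_eq_single (m 0)]
      · rw [spinZ, Matrix.diagonal_apply_eq]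
      · intro l _ hl
        rw [spinZ, Matrix.diagonal_apply_ne _ hl, zero_smul]
      · simp
    rw [creator_succ, lie_mul_eq, hfirst, ih, totalTwoM_succ, smul_mul_assoc, mul_smul_comm,
      ← add_smul]
    push_cast
    rw [add_div]

theorem secondQuantized_spinZ_mulVec_stateOf {A : Matrix (Finset (Mode S)) (Finset (Mode S)) ℂ}
    {μ : ℂ} (hA : ⁅secondQuantized S spinZ, A⁆ = μ • A) :
    secondQuantized S spinZ *ᵥ stateOf S A = μ • stateOf S A := by
  rw [Ring.lie_def, sub_eq_iff_eq_add] at hA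
  rw [stateOf, Matrix.mulVec_mulVec, hA, Matrix.add_mulVec, Matrix.smul_mulVec,
    ← Matrix.mulVec_mulVec _ A, secondQuantized_mulVec_vacuum, Matrix.mulVec_zero, add_zero]

theorem secondQuantized_spinZ_mulVec_stateOf_creator (s : S) {p : ℕ}
    (m : Fin p → Fin (s.1.twoJ + 1)) :
    secondQuantized S spinZ *ᵥ stateOf S (creator S s m) =
      ((totalTwoM m / 2 : ℝ) : ℂ) • stateOf S (creator S s m) := by
  push_cast
  exact secondQuantized_spinZ_mulVec_stateOf S (lie_secondQuantized_spinZ_creator S s m)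

theorem secondQuantized_spinZ_mulVec_stateOf_creator_mul_creator (s t : S) {p q : ℕ}
    (m : Fin p → Fin (s.1.twoJ + 1)) (l : Fin q → Fin (t.1.twoJ + 1)) :
    secondQuantized S spinZ *ᵥ stateOf S (creator S s m * creator S t l) =
      (((totalTwoM m + totalTwoM l : ℤ) / 2 : ℝ) : ℂ) •
        stateOf S (creator S s m * creator S t l) := by
  push_cast
  refine secondQuantized_spinZ_mulVec_stateOf S ?_
  rw [lie_mul_eq, lie_secondQuantized_spinZ_creator, lie_secondQuantized_spinZ_creator,
    smul_mul_assoc, mul_smul_comm, ← add_smul, add_div]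

theorem star_stateOf_creator_dotProduct_of_ne (s : S) {p : ℕ}
    {m m' : Fin p → Fin (s.1.twoJ + 1)} (hne : totalTwoM m' ≠ totalTwoM m) :
    star (stateOf S (creator S s m')) ⬝ᵥ stateOf S (creator S s m) = 0 := by
  refine star_dotProduct_eq_zero_of_isHermitian (secondQuantized_isHermitian S spinZ_isHermitian)
    (secondQuantized_spinZ_mulVec_stateOf_creator S s m')
    (secondQuantized_spinZ_mulVec_stateOf_creator S s m) fun heq => hne ?_
  exact_mod_cast (div_left_inj' (two_ne_zero' ℝ)).1 heq

/-! ### Overlaps and rotations of states with particles in one or two shells -/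

theorem hasParticleNumber_creator_mulVec {n : ℕ} {v : Finset (Mode S) → ℂ}
    (hv : HasParticleNumber n v) (s : S) {p : ℕ} (m : Fin p → Fin (s.1.twoJ + 1)) :
    HasParticleNumber (n + p) (creator S s m *ᵥ v) := by
  induction p with
  | zero => simpa [creator_zero] using hv
  | succ p ih =>
    rw [creator_succ, ← Matrix.mulVec_mulVec]
    exact (ih _).create_mulVec _

theorem hasParticleNumber_creator_conjTranspose_mulVec {n : ℕ} (s : S) {p : ℕ}
    {v : Finset (Mode S) → ℂ} (hv : HasParticleNumber (n + p) v)
    (m : Fin p → Fin (s.1.twoJ + 1)) :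
    HasParticleNumber n ((creator S s m)ᴴ *ᵥ v) := by
  induction p generalizing v with
  | zero => simpa [creator_zero] using hv
  | succ p ih =>
    rw [creator_succ, Matrix.conjTranspose_mul, ← Matrix.mulVec_mulVec]
    exact ih (hv.create_conjTranspose_mulVec _) _

theorem creator_mul_createIn (s t : S) {p : ℕ} (m : Fin p → Fin (s.1.twoJ + 1))
    (l : Fin (t.1.twoJ + 1)) :
    creator S s m * createIn S t l = (-1 : ℂ) ^ p • (createIn S t l * creator S s m) := by
  induction p with
  | zero => simp [creator_zero]
  | succ p ih =>
    rw [creator_succ, mul_assoc, ih, mul_smul_comm, ← mul_assoc, createIn_mul_createIn S s t,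
      neg_mul, mul_assoc, pow_succ, mul_neg_one, neg_smul, smul_neg]

theorem creator_conjTranspose_mul_createIn {s t : S} (hst : s ≠ t) {p : ℕ}
    (m : Fin p → Fin (s.1.twoJ + 1)) (l : Fin (t.1.twoJ + 1)) :
    (creator S s m)ᴴ * createIn S t l = (-1 : ℂ) ^ p • (createIn S t l * (creator S s m)ᴴ) := by
  induction p with
  | zero => simp [creator_zero]
  | succ p ih =>
    have hfirst : (createIn S s (m 0))ᴴ * createIn S t l =
        -(createIn S t l * (createIn S s (m 0))ᴴ) :=
      annihilateIn_mul_createIn_of_ne S hst (m 0) l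
    rw [creator_succ, Matrix.conjTranspose_mul, mul_assoc, hfirst, mul_neg, ← mul_assoc, ih,
      smul_mul_assoc, mul_assoc, pow_succ, mul_neg_one, neg_smul]

theorem commute_creator_conjTranspose_mul_creator {s t : S} (hst : s ≠ t) {p q : ℕ}
    (m m' : Fin p → Fin (s.1.twoJ + 1)) (l : Fin q → Fin (t.1.twoJ + 1)) :
    Commute ((creator S s m')ᴴ * creator S s m) (creator S t l) := by
  refine Commute.list_prod_right _ _ fun x hx => ?_
  obtain ⟨i, rfl⟩ := (List.mem_ofFn' _ _).1 hx
  rw [Commute, SemiconjBy, mul_assoc, creator_mul_createIn, mul_smul_comm, ← mul_assoc,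
    creator_conjTranspose_mul_createIn S hst, smul_mul_assoc, smul_smul, ← mul_pow, mul_assoc]
  simp

theorem star_stateOf_dotProduct (A B : Matrix (Finset (Mode S)) (Finset (Mode S)) ℂ) :
    star (stateOf S A) ⬝ᵥ stateOf S B =
      star (vacuum (Mode S)) ⬝ᵥ ((Aᴴ * B) *ᵥ vacuum (Mode S)) := by
  rw [stateOf, stateOf, Matrix.star_mulVec, ← Matrix.dotProduct_mulVec, Matrix.mulVec_mulVec]

-- `(creator S s m')ᴴ * creator S s m` commutes with the operators of the shell `t` and conserves
-- the particle number, so it may be moved to the vacuum, on which it acts as a scalar.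
theorem star_stateOf_creator_mul_creator_dotProduct {s t : S} (hst : s ≠ t) {p q : ℕ}
    (m m' : Fin p → Fin (s.1.twoJ + 1)) (l l' : Fin q → Fin (t.1.twoJ + 1)) :
    star (stateOf S (creator S s m' * creator S t l')) ⬝ᵥ
      stateOf S (creator S s m * creator S t l) =
      (star (stateOf S (creator S s m')) ⬝ᵥ stateOf S (creator S s m)) *
      (star (stateOf S (creator S t l')) ⬝ᵥ stateOf S (creator S t l)) := by
  have hnumber :
      HasParticleNumber 0 (((creator S s m')ᴴ * creator S s m) *ᵥ vacuum (Mode S)) := by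
    rw [← Matrix.mulVec_mulVec]
    exact hasParticleNumber_creator_conjTranspose_mulVec S s
      (hasParticleNumber_creator_mulVec S hasParticleNumber_vacuum s m) m'
  have hreorder : (creator S s m' * creator S t l')ᴴ * (creator S s m * creator S t l) =
      ((creator S t l')ᴴ * creator S t l) * ((creator S s m')ᴴ * creator S s m) := by
    rw [mul_assoc _ (creator S t l), ← (commute_creator_conjTranspose_mul_creator S hst m m' l).eq,
      Matrix.conjTranspose_mul]
    simp only [mul_assoc]
  simp only [star_stateOf_dotProduct]
  rw [hreorder, ← Matrix.mulVec_mulVec, hnumber.eq_smul_vacuum, Matrix.mulVec_smul,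
    dotProduct_smul, smul_eq_mul, ← hnumber.eq_smul_vacuum]

/-- The product `φ†` with each factor `a†_{s, m_i}` replaced by `∑ l, R l (m i) a†_{s, l}`, expanded
into products of creation operators: the effect on `φ†` of a one-body transformation whose matrix
in the shell `s` is `R`. -/
def transformedCreator (s : S) (R : Matrix (Fin (s.1.twoJ + 1)) (Fin (s.1.twoJ + 1)) ℂ) {p : ℕ}
    (m : Fin p → Fin (s.1.twoJ + 1)) : Matrix (Finset (Mode S)) (Finset (Mode S)) ℂ :=
  ∑ L : Fin p → Fin (s.1.twoJ + 1), (∏ i, R (L i) (m i)) • creator S s L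

theorem transformedCreator_succ (s : S) (R : Matrix (Fin (s.1.twoJ + 1)) (Fin (s.1.twoJ + 1)) ℂ)
    {p : ℕ} (m : Fin (p + 1) → Fin (s.1.twoJ + 1)) :
    transformedCreator S s R m =
      (∑ l, R l (m 0) • createIn S s l) * transformedCreator S s R (Fin.tail m) := by
  rw [transformedCreator, ← (Fin.consEquiv fun _ => Fin (s.1.twoJ + 1)).sum_comp,
    Fintype.sum_prod_type, transformedCreator, Finset.sum_mul_sum]
  refine Finset.sum_congr rfl fun l _ => Finset.sum_congr rfl fun L _ => ?_
  rw [Fin.prod_univ_succ, creator_succ, smul_mul_smul_comm]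
  rfl

theorem axisRotation_mul_creator (A : (n : ℕ) → Matrix (Fin (n + 1)) (Fin (n + 1)) ℂ) (t : ℝ)
    (s : S) {p : ℕ} (m : Fin p → Fin (s.1.twoJ + 1)) :
    axisRotation (secondQuantized S A) t * creator S s m =
      transformedCreator S s (axisRotation (A s.1.twoJ) t) m *
        axisRotation (secondQuantized S A) t := by
  induction p with
  | zero => simp [transformedCreator, creator_zero]
  | succ p ih =>
    rw [creator_succ, ← mul_assoc,
      axisRotation_mul_of_lie_eq_sum (lie_secondQuantized_createIn S A s), Finset.sum_mul,
      transformedCreator_succ, mul_assoc, ← ih, Finset.sum_mul]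
    simp only [smul_mul_assoc, mul_assoc]

theorem axisRotation_mulVec_stateOf_creator
    (A : (n : ℕ) → Matrix (Fin (n + 1)) (Fin (n + 1)) ℂ) (t : ℝ) (s : S) {p : ℕ}
    (m : Fin p → Fin (s.1.twoJ + 1)) :
    axisRotation (secondQuantized S A) t *ᵥ stateOf S (creator S s m) =
      stateOf S (transformedCreator S s (axisRotation (A s.1.twoJ) t) m) := by
  rw [stateOf, Matrix.mulVec_mulVec, axisRotation_mul_creator, ← Matrix.mulVec_mulVec,
    axisRotation_secondQuantized_mulVec_vacuum, stateOf]

theorem axisRotation_mulVec_stateOf_creator_mul_creator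
    (A : (n : ℕ) → Matrix (Fin (n + 1)) (Fin (n + 1)) ℂ) (x : ℝ) (s t : S) {p q : ℕ}
    (m : Fin p → Fin (s.1.twoJ + 1)) (l : Fin q → Fin (t.1.twoJ + 1)) :
    axisRotation (secondQuantized S A) x *ᵥ stateOf S (creator S s m * creator S t l) =
      stateOf S (transformedCreator S s (axisRotation (A s.1.twoJ) x) m *
        transformedCreator S t (axisRotation (A t.1.twoJ) x) l) := by
  rw [stateOf, Matrix.mulVec_mulVec, ← mul_assoc, axisRotation_mul_creator, mul_assoc,
    axisRotation_mul_creator, ← mul_assoc, ← Matrix.mulVec_mulVec,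
    axisRotation_secondQuantized_mulVec_vacuum, stateOf]

theorem star_dotProduct_stateOf_transformedCreator (ψ : Finset (Mode S) → ℂ) (s : S)
    (R : Matrix (Fin (s.1.twoJ + 1)) (Fin (s.1.twoJ + 1)) ℂ) {p : ℕ}
    (m : Fin p → Fin (s.1.twoJ + 1)) :
    star ψ ⬝ᵥ stateOf S (transformedCreator S s R m) =
      ∑ L : Fin p → Fin (s.1.twoJ + 1),
        (∏ i, R (L i) (m i)) * (star ψ ⬝ᵥ stateOf S (creator S s L)) := by
  simp only [stateOf, transformedCreator, Matrix.sum_mulVec, dotProduct_sum, Matrix.smul_mulVec,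
    dotProduct_smul, smul_eq_mul]

theorem star_stateOf_dotProduct_stateOf_transformedCreator_mul {s t : S} (hst : s ≠ t)
    (R : Matrix (Fin (s.1.twoJ + 1)) (Fin (s.1.twoJ + 1)) ℂ)
    (R' : Matrix (Fin (t.1.twoJ + 1)) (Fin (t.1.twoJ + 1)) ℂ) {p q : ℕ}
    (m m' : Fin p → Fin (s.1.twoJ + 1)) (l l' : Fin q → Fin (t.1.twoJ + 1)) :
    star (stateOf S (creator S s m' * creator S t l')) ⬝ᵥ
      stateOf S (transformedCreator S s R m * transformedCreator S t R' l) =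
      (star (stateOf S (creator S s m')) ⬝ᵥ stateOf S (transformedCreator S s R m)) *
      (star (stateOf S (creator S t l')) ⬝ᵥ stateOf S (transformedCreator S t R' l)) := by
  have hexpand : stateOf S (transformedCreator S s R m * transformedCreator S t R' l) =
      ∑ L, ∑ L', ((∏ i, R (L i) (m i)) * ∏ i, R' (L' i) (l i)) •
        stateOf S (creator S s L * creator S t L') := by
    simp only [stateOf, transformedCreator, Finset.sum_mul_sum, Matrix.sum_mulVec,
      smul_mul_smul_comm, Matrix.smul_mulVec]
  simp only [hexpand, dotProduct_sum, dotProduct_smul, smul_eq_mul,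
    star_stateOf_creator_mul_creator_dotProduct S hst, star_dotProduct_stateOf_transformedCreator,
    Finset.sum_mul_sum, mul_mul_mul_comm]

theorem matrixElement_axisRotation_mul (A : (n : ℕ) → Matrix (Fin (n + 1)) (Fin (n + 1)) ℂ) (x : ℝ)
    {s t : S} (hst : s ≠ t) {p q : ℕ} (m m' : Fin p → Fin (s.1.twoJ + 1))
    (l l' : Fin q → Fin (t.1.twoJ + 1)) :
    matrixElement (stateOf S (creator S s m' * creator S t l'))
      (axisRotation (secondQuantized S A) x) (stateOf S (creator S s m * creator S t l)) =
      matrixElement (stateOf S (creator S s m')) (axisRotation (secondQuantized S A) x)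
        (stateOf S (creator S s m)) *
      matrixElement (stateOf S (creator S t l')) (axisRotation (secondQuantized S A) x)
        (stateOf S (creator S t l)) := by
  simp only [matrixElement, axisRotation_mulVec_stateOf_creator_mul_creator,
    axisRotation_mulVec_stateOf_creator,
    star_stateOf_dotProduct_stateOf_transformedCreator_mul S hst]

end SecondQuantization

/-! ### Reduction of the projection operator to an integral over `β` -/

section MatrixElement

variable {κ : Type*}

theorem continuous_of_integral {X : Type*} [TopologicalSpace X] {F : X → ℝ → Matrix κ κ ℂ}
    (hF : Continuous fun p : X × ℝ => F p.1 p.2) (a b : ℝ) :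
    Continuous fun x => Matrix.of fun k l => ∫ y in a..b, F x y k l :=
  continuous_matrix fun k l =>
    intervalIntegral.continuous_parametric_intervalIntegral_of_continuous'
      (hF.matrix_elem k l) a b

variable [Fintype κ]

theorem matrixElement_smul (ψ : κ → ℂ) (c : ℂ) (A : Matrix κ κ ℂ) (φ : κ → ℂ) :
    matrixElement ψ (c • A) φ = c * matrixElement ψ A φ := by
  rw [matrixElement, Matrix.smul_mulVec, dotProduct_smul, smul_eq_mul, matrixElement]

theorem matrixElement_of_integral {F : ℝ → Matrix κ κ ℂ} (hF : Continuous F) (ψ φ : κ → ℂ)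
    (a b : ℝ) :
    matrixElement ψ (Matrix.of fun k l => ∫ x in a..b, F x k l) φ =
      ∫ x in a..b, matrixElement ψ (F x) φ := by
  have hentry (k l : κ) : Continuous fun x => F x k l := hF.matrix_elem k l
  have hintegrable {f : ℝ → ℂ} (hf : Continuous f) :
      IntervalIntegrable f MeasureTheory.volume a b :=
    hf.intervalIntegrable a b
  simp only [matrixElement, dotProduct, Matrix.mulVec, Matrix.of_apply]
  rw [intervalIntegral.integral_finsetSum fun k _ => hintegrable (by fun_prop)]
  refine Finset.sum_congr rfl fun k _ => ?_
  rw [intervalIntegral.integral_const_mul,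
    intervalIntegral.integral_finsetSum fun l _ => hintegrable (by fun_prop)]
  simp only [intervalIntegral.integral_mul_const]

theorem matrixElement_of_integral_integral_integral {F : ℝ → ℝ → ℝ → Matrix κ κ ℂ}
    (hF : Continuous fun x : ℝ × ℝ × ℝ => F x.1 x.2.1 x.2.2) (ψ φ : κ → ℂ)
    (a₁ b₁ a₂ b₂ a₃ b₃ : ℝ) :
    matrixElement ψ (Matrix.of fun k l =>
        ∫ x in a₁..b₁, ∫ y in a₂..b₂, ∫ z in a₃..b₃, F x y z k l) φ =
      ∫ x in a₁..b₁, ∫ y in a₂..b₂, ∫ z in a₃..b₃, matrixElement ψ (F x y z) φ := by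
  have hcurry {X : Type} [TopologicalSpace X] {f : X → ℝ × ℝ × ℝ} (hf : Continuous f) :
      Continuous fun x => F (f x).1 (f x).2.1 (f x).2.2 := hF.comp hf
  have hz : Continuous fun p : ℝ × ℝ => Matrix.of fun k l => ∫ z in a₃..b₃, F p.1 p.2 z k l :=
    continuous_of_integral (F := fun p : ℝ × ℝ => F p.1 p.2)
      (hcurry (f := fun q : (ℝ × ℝ) × ℝ => (q.1.1, q.1.2, q.2)) (by fun_prop)) a₃ b₃
  refine (matrixElement_of_integral (continuous_of_integral hz a₂ b₂) ψ φ a₁ b₁).trans ?_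
  refine intervalIntegral.integral_congr fun x _ => ?_
  refine (matrixElement_of_integral (hz.comp (Continuous.prodMk_right x)) ψ φ a₂ b₂).trans ?_
  refine intervalIntegral.integral_congr fun y _ => ?_
  exact matrixElement_of_integral
    (hcurry (f := fun z => (x, y, z)) (by fun_prop)) ψ φ a₃ b₃

end MatrixElement

theorem continuous_wignerD (n : ℕ) (M' M : ℤ) :
    Continuous fun x : ℝ × ℝ × ℝ => wignerD n M' M x.1 x.2.1 x.2.2 :=
  continuous_const.dotProduct
    ((continuous_eulerRotation (spinZ n) (spinY n)).matrix_mulVec continuous_const)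

theorem star_exp_mul_exp (x y : ℝ) :
    star (Complex.exp (-Complex.I * x * y)) * Complex.exp (-Complex.I * x * y) = 1 := by
  rw [Complex.star_def, ← Complex.exp_conj, ← Complex.exp_add]
  simp

-- The dependence on `α` and `γ` is a phase on each side, and the phases cancel.
theorem star_wignerD_mul_matrixElement_eulerRotation {κ : Type*} [Fintype κ] [DecidableEq κ]
    {Z : Matrix κ κ ℂ} (hZ : Z.IsHermitian) (Y : Matrix κ κ ℂ) {M' M : ℤ} {ψ φ : κ → ℂ}
    (hψ : Z *ᵥ ψ = ((M' / 2 : ℝ) : ℂ) • ψ) (hφ : Z *ᵥ φ = ((M / 2 : ℝ) : ℂ) • φ) (n : ℕ)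
    (α β γ : ℝ) :
    star (wignerD n M' M α β γ) * matrixElement ψ (eulerRotation Z Y α β γ) φ =
      star (reducedWigner n M' M β) * matrixElement ψ (axisRotation Y β) φ := by
  rw [wignerD, star_dotProduct_eulerRotation_mulVec (spinZ_isHermitian n) _
    (spinZ_mulVec_ket n M') (spinZ_mulVec_ket n M), matrixElement,
    star_dotProduct_eulerRotation_mulVec hZ Y hψ hφ, star_mul', star_mul', ← reducedWigner,
    mul_mul_mul_comm, mul_mul_mul_comm (star _), star_exp_mul_exp, star_exp_mul_exp, one_mul,
    one_mul, matrixElement]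

/-- The coefficient `(2J + 1) / 2 ∫ sin β d^J_{M' M}(β)^* f(β) dβ` of `d^J_{M' M}` in the expansion
of `f` in reduced Wigner functions, with `n = 2J`. -/
def wignerCoeff (n : ℕ) (M' M : ℤ) (f : ℝ → ℂ) : ℂ :=
  ((n : ℂ) + 1) / 2 * ∫ β in (0 : ℝ)..Real.pi,
    (Real.sin β : ℂ) * (star (reducedWigner n M' M β) * f β)

theorem matrixElement_projection {N : Type*} (S : Finset (Shell N)) [LinearOrder (Mode S)]
    {M' M : ℤ} {ψ φ : Finset (Mode S) → ℂ}
    (hψ : secondQuantized S spinZ *ᵥ ψ = ((M' / 2 : ℝ) : ℂ) • ψ)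
    (hφ : secondQuantized S spinZ *ᵥ φ = ((M / 2 : ℝ) : ℂ) • φ) (n : ℕ) :
    matrixElement ψ (projection S n M' M) φ = wignerCoeff n M' M fun β =>
      matrixElement ψ (axisRotation (secondQuantized S spinY) β) φ := by
  have hcont : Continuous fun x : ℝ × ℝ × ℝ =>
      ((Real.sin x.2.1 : ℂ) * star (wignerD n M' M x.1 x.2.1 x.2.2)) •
        fockRotation S x.1 x.2.1 x.2.2 := by
    have hD := continuous_wignerD n M' M
    have hscalar : Continuous fun x : ℝ × ℝ × ℝ =>
        (Real.sin x.2.1 : ℂ) * star (wignerD n M' M x.1 x.2.1 x.2.2) := by fun_prop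
    exact hscalar.smul (continuous_eulerRotation _ _)
  have hintegrand (α β γ : ℝ) :
      matrixElement ψ (((Real.sin β : ℂ) * star (wignerD n M' M α β γ)) •
        fockRotation S α β γ) φ = (Real.sin β : ℂ) * (star (reducedWigner n M' M β) *
          matrixElement ψ (axisRotation (secondQuantized S spinY) β) φ) := by
    rw [matrixElement_smul, mul_assoc, fockRotation, star_wignerD_mul_matrixElement_eulerRotation
      (secondQuantized_isHermitian S spinZ_isHermitian) _ hψ hφ]
  have hpull : matrixElement ψ (projection S n M' M) φ = ((n : ℂ) + 1) / (8 * (Real.pi : ℂ) ^ 2) *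
      ∫ α in (0 : ℝ)..(2 * Real.pi), ∫ β in (0 : ℝ)..Real.pi, ∫ γ in (0 : ℝ)..(2 * Real.pi),
        matrixElement ψ (((Real.sin β : ℂ) * star (wignerD n M' M α β γ)) •
          fockRotation S α β γ) φ :=
    (matrixElement_smul ψ _ _ φ).trans
      (congrArg _ (matrixElement_of_integral_integral_integral hcont ψ φ _ _ _ _ _ _))
  have hpi : (Real.pi : ℂ) ≠ 0 := Complex.ofReal_ne_zero.2 Real.pi_ne_zero
  simp only [hpull, hintegrand, intervalIntegral.integral_const, Complex.real_smul, wignerCoeff]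
  rw [intervalIntegral.integral_const_mul]
  push_cast
  field_simp
  ring

/-! ### Expansions in reduced Wigner functions -/

theorem wignerCoeff_sum_smul {κ : Type*} (n : ℕ) (M' M : ℤ) (s : Finset κ) (w : κ → ℂ)
    {f : κ → ℝ → ℂ} (hf : ∀ i, Continuous (f i)) :
    wignerCoeff n M' M (∑ i ∈ s, w i • f i) = ∑ i ∈ s, w i * wignerCoeff n M' M (f i) := by
  have hcont (i : κ) : Continuous fun β : ℝ =>
      (Real.sin β : ℂ) * (star (reducedWigner n M' M β) * f i β) := by
    fun_prop
  simp only [wignerCoeff, Finset.sum_apply, Pi.smul_apply, smul_eq_mul, Finset.mul_sum,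
    mul_left_comm _ (w _)]
  rw [intervalIntegral.integral_finsetSum fun i _ =>
    ((hcont i).const_mul (w i)).intervalIntegrable _ _]
  simp only [intervalIntegral.integral_const_mul, Finset.mul_sum, mul_left_comm _ (w _)]

theorem exists_twoM_or_reducedWigner_eq_zero (n : ℕ) (M' M : ℤ) :
    (∃ k l, twoM n k = M' ∧ twoM n l = M) ∨ reducedWigner n M' M = 0 := by
  by_cases hM' : ∃ k, twoM n k = M'
  · by_cases hM : ∃ l, twoM n l = M
    · obtain ⟨⟨k, hk⟩, ⟨l, hl⟩⟩ := And.intro hM' hM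
      exact .inl ⟨k, l, hk, hl⟩
    · exact .inr (funext (reducedWigner_eq_zero_right (not_exists.1 hM) M'))
  · exact .inr (funext (reducedWigner_eq_zero_left (not_exists.1 hM') M))

theorem wignerCoeff_reducedWigner_twoM {n : ℕ} (c : ℕ) (k l : Fin (n + 1)) :
    wignerCoeff n (twoM n k) (twoM n l) (reducedWigner c (twoM n k) (twoM n l)) =
      if n = c then 1 else 0 := by
  have hn : (n : ℂ) + 1 ≠ 0 := Nat.cast_add_one_ne_zero n
  rw [wignerCoeff, integral_sin_mul_star_reducedWigner_mul]
  split_ifs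
  · field_simp
  · rw [mul_zero]

theorem wignerCoeff_reducedWigner_of_ne {n c : ℕ} (hnc : n ≠ c) (M' M : ℤ) :
    wignerCoeff n M' M (reducedWigner c M' M) = 0 := by
  rcases exists_twoM_or_reducedWigner_eq_zero n M' M with ⟨k, l, rfl, rfl⟩ | hzero
  · rw [wignerCoeff_reducedWigner_twoM, if_neg hnc]
  · simp [wignerCoeff, hzero]

theorem wignerCoeff_self_smul_reducedWigner (n : ℕ) (M' M : ℤ) :
    wignerCoeff n M' M (reducedWigner n M' M) • reducedWigner n M' M = reducedWigner n M' M := by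
  rcases exists_twoM_or_reducedWigner_eq_zero n M' M with ⟨k, l, rfl, rfl⟩ | hzero
  · rw [wignerCoeff_reducedWigner_twoM, if_pos rfl, one_smul]
  · rw [hzero, smul_zero]

theorem reducedWigner_mul_reducedWigner_eq_sum_smul (a b : ℕ) (M₁' M₁ M₂' M₂ : ℤ) :
    reducedWigner a M₁' M₁ * reducedWigner b M₂' M₂ =
      ∑ c ∈ couplings a b, (clebschGordan a M₁' b M₂' c (M₁' + M₂') *
        clebschGordan a M₁ b M₂ c (M₁ + M₂)) • reducedWigner c (M₁' + M₂') (M₁ + M₂) := by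
  ext β
  simpa using reducedWigner_mul_reducedWigner M₁' M₁ M₂' M₂ β

theorem clebschGordan_mul_wignerCoeff_self (a b c : ℕ) (M₁' M₁ M₂' M₂ M' M : ℤ) :
    clebschGordan a M₁' b M₂' c M' * clebschGordan a M₁ b M₂ c M *
        wignerCoeff c M' M (reducedWigner c M' M) =
      clebschGordan a M₁' b M₂' c M' * clebschGordan a M₁ b M₂ c M := by
  by_cases hM' : ∃ k, twoM c k = M'
  · by_cases hM : ∃ l, twoM c l = M
    · obtain ⟨⟨k, rfl⟩, ⟨l, rfl⟩⟩ := And.intro hM' hM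
      rw [wignerCoeff_reducedWigner_twoM, if_pos rfl, mul_one]
    · simp [clebschGordan_eq_zero (not_exists.1 hM)]
  · simp [clebschGordan_eq_zero (not_exists.1 hM')]

theorem wignerCoeff_reducedWigner_mul_reducedWigner (n a b : ℕ) (M₁' M₁ M₂' M₂ : ℤ) :
    wignerCoeff n (M₁' + M₂') (M₁ + M₂) (reducedWigner a M₁' M₁ * reducedWigner b M₂' M₂) =
      clebschGordan a M₁' b M₂' n (M₁' + M₂') * clebschGordan a M₁ b M₂ n (M₁ + M₂) := by
  rw [reducedWigner_mul_reducedWigner_eq_sum_smul,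
    wignerCoeff_sum_smul _ _ _ _ _ fun c => continuous_reducedWigner c _ _,
    Finset.sum_eq_single n]
  · exact clebschGordan_mul_wignerCoeff_self a b n M₁' M₁ M₂' M₂ _ _
  · intro c _ hcn
    rw [wignerCoeff_reducedWigner_of_ne hcn.symm, mul_zero]
  · intro hn
    rw [clebschGordan_of_not_triangle (mt mem_couplings.2 hn), zero_mul, zero_mul]

/-- The functions of `β` with a finite expansion in the reduced Wigner functions `d^J_{M' M}` for
fixed `M'` and `M`. -/
def wignerSpan (M' M : ℤ) : Submodule ℂ (ℝ → ℂ) :=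
  Submodule.span ℂ (Set.range fun n => reducedWigner n M' M)

theorem reducedWigner_mem_wignerSpan (n : ℕ) (M' M : ℤ) :
    reducedWigner n M' M ∈ wignerSpan M' M :=
  Submodule.subset_span ⟨n, rfl⟩

theorem mul_mem_wignerSpan {f g : ℝ → ℂ} {M₁' M₁ M₂' M₂ : ℤ} (hf : f ∈ wignerSpan M₁' M₁)
    (hg : g ∈ wignerSpan M₂' M₂) : f * g ∈ wignerSpan (M₁' + M₂') (M₁ + M₂) := by
  have hfg := Submodule.mul_mem_mul hf hg
  rw [wignerSpan, wignerSpan, Submodule.span_mul_span] at hfg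
  refine Submodule.span_le.2 ?_ hfg
  rintro _ ⟨_, ⟨a, rfl⟩, _, ⟨b, rfl⟩, rfl⟩
  simp only [reducedWigner_mul_reducedWigner_eq_sum_smul]
  exact Submodule.sum_mem _ fun c _ =>
    Submodule.smul_mem _ _ (reducedWigner_mem_wignerSpan c _ _)

theorem prod_mem_wignerSpan {κ : Type*} {s : Finset κ} {f : κ → ℝ → ℂ} {M' M : κ → ℤ}
    (hf : ∀ i ∈ s, f i ∈ wignerSpan (M' i) (M i)) :
    ∏ i ∈ s, f i ∈ wignerSpan (∑ i ∈ s, M' i) (∑ i ∈ s, M i) := by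
  induction s using Finset.cons_induction with
  | empty => exact Submodule.subset_span ⟨0, funext reducedWigner_zero⟩
  | cons i s hi ih =>
    rw [Finset.forall_mem_cons] at hf
    simp only [Finset.prod_cons, Finset.sum_cons]
    exact mul_mem_wignerSpan hf.1 (ih hf.2)

theorem exists_eq_sum_wignerCoeff_smul {f : ℝ → ℂ} {M' M : ℤ} (hf : f ∈ wignerSpan M' M) :
    ∃ s : Finset ℕ, (∀ n ∉ s, wignerCoeff n M' M f = 0) ∧
      f = ∑ n ∈ s, wignerCoeff n M' M f • reducedWigner n M' M := by
  obtain ⟨w, rfl⟩ := Finsupp.mem_span_range_iff_exists_finsupp.1 hf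
  have hcoeff (n : ℕ) : wignerCoeff n M' M (w.sum fun c a => a • reducedWigner c M' M) =
      w n * wignerCoeff n M' M (reducedWigner n M' M) := by
    rw [Finsupp.sum, wignerCoeff_sum_smul _ _ _ _ _ fun c => continuous_reducedWigner c _ _,
      Finset.sum_eq_single n]
    · intro c _ hcn
      rw [wignerCoeff_reducedWigner_of_ne hcn.symm, mul_zero]
    · intro hn
      rw [Finsupp.notMem_support_iff.1 hn, zero_mul]
  refine ⟨w.support, fun n hn => ?_, Finset.sum_congr rfl fun n _ => ?_⟩
  · rw [hcoeff, Finsupp.notMem_support_iff.1 hn, zero_mul]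
  · rw [hcoeff, mul_smul, wignerCoeff_self_smul_reducedWigner]

theorem wignerCoeff_mul {f g : ℝ → ℂ} {M₁' M₁ M₂' M₂ : ℤ} (hf : f ∈ wignerSpan M₁' M₁)
    (hg : g ∈ wignerSpan M₂' M₂) (n : ℕ) :
    let term (x : ℕ × ℕ) := wignerCoeff x.1 M₁' M₁ f * wignerCoeff x.2 M₂' M₂ g *
      (clebschGordan x.1 M₁' x.2 M₂' n (M₁' + M₂') * clebschGordan x.1 M₁ x.2 M₂ n (M₁ + M₂))
    (Function.support term).Finite ∧
      wignerCoeff n (M₁' + M₂') (M₁ + M₂) (f * g) = ∑ᶠ x, term x := by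
  intro term
  obtain ⟨s, hs, hfs⟩ := exists_eq_sum_wignerCoeff_smul hf
  obtain ⟨t, ht, hgt⟩ := exists_eq_sum_wignerCoeff_smul hg
  have hsupport : Function.support term ⊆ ↑(s ×ˢ t) := by
    rintro ⟨a, b⟩ hab
    rw [Function.mem_support] at hab
    rw [Finset.mem_coe, Finset.mem_product]
    exact ⟨by_contra fun ha => hab (by simp [term, hs a ha]),
      by_contra fun hb => hab (by simp [term, ht b hb])⟩
  have hproduct : f * g = ∑ x ∈ s ×ˢ t, (wignerCoeff x.1 M₁' M₁ f * wignerCoeff x.2 M₂' M₂ g) •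
      (reducedWigner x.1 M₁' M₁ * reducedWigner x.2 M₂' M₂) := by
    conv_lhs => rw [hfs, hgt, Finset.sum_mul_sum, ← Finset.sum_product']
    simp only [smul_mul_smul_comm]
  have hcont (x : ℕ × ℕ) : Continuous (reducedWigner x.1 M₁' M₁ * reducedWigner x.2 M₂' M₂) :=
    (continuous_reducedWigner _ _ _).mul (continuous_reducedWigner _ _ _)
  refine ⟨(s ×ˢ t).finite_toSet.subset hsupport, ?_⟩
  rw [finsum_eq_sum_of_support_subset _ hsupport, hproduct, wignerCoeff_sum_smul _ _ _ _ _ hcont]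
  refine Finset.sum_congr rfl fun x _ => ?_
  rw [wignerCoeff_reducedWigner_mul_reducedWigner]

theorem matrixElement_axisRotation_mem_wignerSpan {N : Type*} (S : Finset (Shell N))
    [LinearOrder (Mode S)] (s : S) {p : ℕ} (m m' : Fin p → Fin (s.1.twoJ + 1)) :
    (fun β => matrixElement (stateOf S (creator S s m'))
      (axisRotation (secondQuantized S spinY) β) (stateOf S (creator S s m))) ∈
      wignerSpan (totalTwoM m') (totalTwoM m) := by
  have hexpand : (fun β => matrixElement (stateOf S (creator S s m'))
      (axisRotation (secondQuantized S spinY) β) (stateOf S (creator S s m))) =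
      ∑ L : Fin p → Fin (s.1.twoJ + 1),
        (star (stateOf S (creator S s m')) ⬝ᵥ stateOf S (creator S s L)) •
          ∏ i, reducedWigner s.1.twoJ (twoM s.1.twoJ (L i)) (twoM s.1.twoJ (m i)) := by
    ext β
    simp only [matrixElement, axisRotation_mulVec_stateOf_creator,
      star_dotProduct_stateOf_transformedCreator, Finset.sum_apply, Pi.smul_apply,
      Finset.prod_apply, reducedWigner_twoM, smul_eq_mul, mul_comm]
  rw [hexpand]
  refine Submodule.sum_mem _ fun L _ => ?_
  by_cases hL : totalTwoM m' = totalTwoM L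
  · rw [hL]
    exact Submodule.smul_mem _ _
      (prod_mem_wignerSpan fun i _ => reducedWigner_mem_wignerSpan _ _ _)
  · rw [star_stateOf_creator_dotProduct_of_ne S s hL, zero_smul]
    exact Submodule.zero_mem _

end

theorem theorem1 {N : Type*} (S : Finset (Shell N)) [LinearOrder (Mode S)] (s₁ s₂ : S)
    (h : s₁.1.twoJ ≠ s₂.1.twoJ ∨ (s₁.1.twoJ = s₂.1.twoJ ∧ s₁.1.ν ≠ s₂.1.ν))
    {p q : ℕ} (m₁ m₁' : Fin p → Fin (s₁.1.twoJ + 1)) (m₂ m₂' : Fin q → Fin (s₂.1.twoJ + 1))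
    (φ₁ φ₁' φ₂ φ₂' φ φ' : Finset (Mode S) → ℂ)
    (hφ₁ : φ₁ = stateOf S (creator S s₁ m₁)) (hφ₁' : φ₁' = stateOf S (creator S s₁ m₁'))
    (hφ₂ : φ₂ = stateOf S (creator S s₂ m₂)) (hφ₂' : φ₂' = stateOf S (creator S s₂ m₂'))
    (hφ : φ = stateOf S (creator S s₁ m₁ * creator S s₂ m₂))
    (hφ' : φ' = stateOf S (creator S s₁ m₁' * creator S s₂ m₂'))
    (M₁ M₁' M₂ M₂' M M' : ℤ)
    (hM₁ : M₁ = totalTwoM m₁) (hM₁' : M₁' = totalTwoM m₁')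
    (hM₂ : M₂ = totalTwoM m₂) (hM₂' : M₂' = totalTwoM m₂')
    (hM : M = M₁ + M₂) (hM' : M' = M₁' + M₂')
    (J : ℕ) (term : ℕ × ℕ → ℂ)
    (hterm : ∀ J₁ J₂ : ℕ, term (J₁, J₂) =
      matrixElement φ₁' (projection S J₁ M₁' M₁) φ₁ *
        matrixElement φ₂' (projection S J₂ M₂' M₂) φ₂ *
          (clebschGordan J₁ M₁' J₂ M₂' J M' * clebschGordan J₁ M₁ J₂ M₂ J M)) :
    (Function.support term).Finite ∧
      matrixElement φ' (projection S J M' M) φ = ∑ᶠ x : ℕ × ℕ, term x := by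
  have hs : s₁ ≠ s₂ := by
    rintro rfl
    rcases h with hj | ⟨-, hν⟩
    · exact hj rfl
    · exact hν rfl
  subst hφ₁ hφ₁' hφ₂ hφ₂' hφ hφ' hM₁ hM₁' hM₂ hM₂' hM hM'
  have hZ := secondQuantized_spinZ_mulVec_stateOf_creator S
  have hZmul := @secondQuantized_spinZ_mulVec_stateOf_creator_mul_creator N S _ s₁ s₂ p q
  have hspan := @matrixElement_axisRotation_mem_wignerSpan N S _
  rw [matrixElement_projection S (hZmul m₁' m₂') (hZmul m₁ m₂)]
  simp only [matrixElement_projection S (hZ s₁ m₁') (hZ s₁ m₁),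
    matrixElement_projection S (hZ s₂ m₂') (hZ s₂ m₂)] at hterm
  rw [show term = _ from funext fun x => hterm x.1 x.2]
  simp only [matrixElement_axisRotation_mul S _ _ hs]
  exact wignerCoeff_mul (hspan s₁ m₁ m₁') (hspan s₂ m₂ m₂') J
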